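/- Let $p$ be a prime, $n\ge 0$ an integer, $G=(\mathbb Z/p)^n$, and let $k$ be a field of characteristic $p$. Let $A=k[x_1,\dots,x_n]$ be the polynomial ring graded by $\deg(x_i)=-1$. A $p$-DG $A$-module is a $\mathbb Z$-graded $A$-module $M$ together with an $A$-linear map $d\colon M\to M$ of degree $-1$ such that $d^p=0$. It is called finitely generated if the underlying $A$-module is finitely generated, and free if the underlying graded $A$-module is a direct sum of shifts of $A$. For $1\le s\le p-1$ and $i\in\mathbb Z$ put $${}_sH_i(M)=\frac{\ker(d^s\colon M_i\to M_{i-s})}{\operatorname{im}(d^{p-s}\colon M_{i+p-s}\to M_i)},\qquad {}_sH_\bullet(M)=\bigoplus_{i\in\mathbb Z}{}_sH_i(M),$$ and define ${}_sH_i(M\otimes_A k)$ and ${}_sH_\bullet(M\otimes_A k)$ in the same way for the graded $k$-vector space $M\otimes_A k$ with the differential $d\otimes\mathrm{id}$, where $k=A/(x_1,\dots,x_n)$. Consider the finitely generated, free $p$-DG $A$-modules $M$ such that ${}_sH_\bullet(M\otimes_A k)\neq 0$ and $\dim_k {}_sH_\bullet(M)<\infty$ for all $1\le s\le p-1$. Then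 the minimum $$b_n=\min_M\ \sum_{i\in\mathbb Z}\dim_k {}_1H_i(M\otimes_A k)$$ over all such $M$ exists and is finite, and $$\sum_{i\in\mathbb Z}\dim_k H_i(C)\ \ge\ b_n$$ for every non-acyclic perfect chain complex $C$ over $k[G]$, where a perfect chain complex is a bounded complex of finitely generated projective $k[G]$-modules. -/

import Mathlib

open scoped TensorProduct DirectSum

universe u v

noncomputable section

/-- The dimension of a vector space, as an element of `{0, 1, 2, …, ∞}`. -/
def eDim (k : Type u) [Field k] (V : Type v) [AddCommGroup V] [Module k V] : ℕ∞ :=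
  Cardinal.toENat (Module.rank k V)

/-- An `N`-complex of `k`-vector spaces: a `ℤ`-graded vector space with an endomorphism `d` of
degree `-1` such that `d ^ N = 0`. -/
structure NComplex (N : ℕ) (k : Type u) [Field k] where
  carrier : Type v
  [addCommGroup : AddCommGroup carrier]
  [module : Module k carrier]
  grading : ℤ → Submodule k carrier
  isInternal : DirectSum.IsInternal grading
  d : carrier →ₗ[k] carrier
  d_mem : ∀ (i : ℤ) (x : carrier), x ∈ grading i → d x ∈ grading (i - 1)
  d_pow : d ^ N = 0

namespace NComplex

attribute [instance] NComplex.addCommGroup NComplex.module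

variable {N : ℕ} {k : Type u} [Field k] (C : NComplex.{u, v} N k)

/-- The kernel of `d ^ s : C_i → C_{i-s}`. -/
def cycles (s : ℕ) (i : ℤ) : Submodule k C.carrier :=
  C.grading i ⊓ LinearMap.ker (C.d ^ s)

/-- The image of `d ^ (N - s) : C_{i+N-s} → C_i`. -/
def boundaries (s : ℕ) (i : ℤ) : Submodule k C.carrier :=
  (C.grading (i + N - s)).map (C.d ^ (N - s))

/-- The homology `ₛH_i(C)`, meaningful for `1 ≤ s ≤ N - 1`. The boundaries are contained in the
cycles then, and are regarded as a subspace of the cycles. -/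
abbrev homology (s : ℕ) (i : ℤ) : Type v :=
  C.cycles s i ⧸ (C.boundaries s i).submoduleOf (C.cycles s i)

/-- The total homology `ₛH_•(C)`, the direct sum of the `ₛH_i(C)` over all integers `i`. -/
abbrev totalHomology (s : ℕ) : Type v :=
  ⨁ i : ℤ, C.homology s i

/-- The sum over all integers `i` of the dimensions of `ₛH_i(C)`. -/
def homologyDim (s : ℕ) : ℕ∞ :=
  ∑' i : ℤ, eDim k (C.homology s i)

end NComplex

/-- The grading of the polynomial ring `k[x_1, …, x_n]` in which every `x_i` has degree `-1`. -/
def polyGrading (n : ℕ) (k : Type u) [Field k] : ℤ → Submodule k (MvPolynomial (Fin n) k) :=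
  MvPolynomial.weightedHomogeneousSubmodule k (fun _ : Fin n => (-1 : ℤ))

/-- The ideal `(x_1, …, x_n)` of `k[x_1, …, x_n]`. -/
def augIdeal (n : ℕ) (k : Type u) [Field k] : Ideal (MvPolynomial (Fin n) k) :=
  Ideal.span (Set.range MvPolynomial.X)

/-- A `p`-differential graded module over `A = k[x_1, …, x_n]`, `deg x_i = -1`: a `ℤ`-graded
`A`-module with an `A`-linear endomorphism `d` of degree `-1` such that `d ^ p = 0`. The graded
pieces are `k`-subspaces; the `k`-action is the restriction of the `A`-action. -/
structure PDGModule (p n : ℕ) (k : Type u) [Field k] where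
  carrier : Type v
  [addCommGroup : AddCommGroup carrier]
  [moduleBase : Module k carrier]
  [module : Module (MvPolynomial (Fin n) k) carrier]
  [isScalarTower : IsScalarTower k (MvPolynomial (Fin n) k) carrier]
  grading : ℤ → Submodule k carrier
  isInternal : DirectSum.IsInternal grading
  smul_mem : ∀ (i j : ℤ) (a : MvPolynomial (Fin n) k) (m : carrier),
    a ∈ polyGrading n k i → m ∈ grading j → a • m ∈ grading (i + j)
  d : carrier →ₗ[MvPolynomial (Fin n) k] carrier
  d_mem : ∀ (i : ℤ) (m : carrier), m ∈ grading i → d m ∈ grading (i - 1)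
  d_pow : d ^ p = 0

namespace PDGModule

attribute [instance] PDGModule.addCommGroup PDGModule.moduleBase PDGModule.module
  PDGModule.isScalarTower

variable {p n : ℕ} {k : Type u} [Field k] (M : PDGModule.{u, v} p n k)

/-- The underlying graded `A`-module is free, that is, a direct sum of shifts of `A`: it has an
`A`-basis of homogeneous elements. -/
def IsFree : Prop :=
  ∃ (ι : Type v) (b : Module.Basis ι (MvPolynomial (Fin n) k) M.carrier) (c : ι → ℤ),
    ∀ j, b j ∈ M.grading (c j)

/-- The underlying `A`-module is finitely generated. -/
def IsFG : Prop := Module.Finite (MvPolynomial (Fin n) k) M.carrier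

/-- The underlying `p`-complex of `k`-vector spaces. -/
def toNComplex : NComplex.{u, v} p k where
  carrier := M.carrier
  grading := M.grading
  isInternal := M.isInternal
  d := M.d.restrictScalars k
  d_mem := M.d_mem
  d_pow := by
    ext m
    have h := LinearMap.congr_fun M.d_pow m
    rw [Module.End.pow_apply] at h ⊢
    exact h

/-- The underlying vector space of `M ⊗_A k`, with `k` identified with `A / (x_1, …, x_n)`. -/
abbrev Fiber : Type (max v u) :=
  M.carrier ⊗[MvPolynomial (Fin n) k] (MvPolynomial (Fin n) k ⧸ augIdeal n k)

/-- The `k`-linear map `M → M ⊗_A k`, `m ↦ m ⊗ 1`. -/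
def toFiber : M.carrier →ₗ[k] M.Fiber :=
  ((TensorProduct.mk (MvPolynomial (Fin n) k) M.carrier
    (MvPolynomial (Fin n) k ⧸ augIdeal n k)).flip 1).restrictScalars k

/-- The degree `i` part of `M ⊗_A k`, spanned by the `m ⊗ 1` with `m` of degree `i`. -/
def fiberGrading (i : ℤ) : Submodule k M.Fiber := (M.grading i).map M.toFiber

/-- The differential `d ⊗ id` of `M ⊗_A k`. -/
def fiberD : M.Fiber →ₗ[k] M.Fiber :=
  (M.d.rTensor (MvPolynomial (Fin n) k ⧸ augIdeal n k)).restrictScalars k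

theorem toFiber_surjective : Function.Surjective M.toFiber := by
  intro t
  induction t using TensorProduct.induction_on with
  | zero => exact ⟨0, map_zero _⟩
  | tmul m a =>
    obtain ⟨a, rfl⟩ := Ideal.Quotient.mk_surjective a
    refine ⟨a • m, ?_⟩
    change (a • m) ⊗ₜ (1 : MvPolynomial (Fin n) k ⧸ augIdeal n k) = _
    rw [TensorProduct.smul_tmul]
    congr 1
    exact mul_one (Ideal.Quotient.mk (augIdeal n k) a)
  | add x y hx hy =>
    obtain ⟨a, rfl⟩ := hx
    obtain ⟨b, rfl⟩ := hy
    exact ⟨a + b, map_add _ _ _⟩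

theorem toFiber_eq_zero_iff (m : M.carrier) :
    M.toFiber m = 0 ↔ m ∈ augIdeal n k • (⊤ : Submodule (MvPolynomial (Fin n) k) M.carrier) := by
  rw [← Submodule.Quotient.mk_eq_zero,
    ← (TensorProduct.tensorQuotEquivQuotSMul M.carrier (augIdeal n k)).symm.map_eq_zero_iff,
    TensorProduct.tensorQuotEquivQuotSMul_symm_mk]
  rfl

/-- The projection of `M` to its degree `i` part. -/
def proj (i : ℤ) : M.carrier →ₗ[k] M.carrier :=
  (M.grading i).subtype ∘ₗ DirectSum.component k ℤ (fun i => M.grading i) i ∘ₗ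
    (LinearEquiv.ofBijective (DirectSum.coeLinearMap M.grading) M.isInternal).symm.toLinearMap

theorem proj_of_mem {i j : ℤ} {m : M.carrier} (hm : m ∈ M.grading j) :
    M.proj i m = if j = i then m else 0 := by
  have h : (LinearEquiv.ofBijective (DirectSum.coeLinearMap M.grading) M.isInternal).symm m =
      DirectSum.lof k ℤ (fun i => M.grading i) j ⟨m, hm⟩ := by
    rw [LinearEquiv.symm_apply_eq]
    exact (DirectSum.coeLinearMap_lof M.grading j (⟨m, hm⟩ : M.grading j)).symm
  simp only [proj, LinearMap.comp_apply, LinearEquiv.coe_coe, h]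
  split_ifs with hij
  · subst hij
    rw [DirectSum.component.lof_self]
    rfl
  · rw [DirectSum.component.of, dif_neg hij]
    rfl

theorem proj_X_smul (i : ℤ) (j : Fin n) (m : M.carrier) :
    M.proj i ((MvPolynomial.X j : MvPolynomial (Fin n) k) • m) =
      (MvPolynomial.X j : MvPolynomial (Fin n) k) • M.proj (i + 1) m := by
  have hm : m ∈ ⨆ l, M.grading l := by
    rw [M.isInternal.submodule_iSup_eq_top]; trivial
  have hX : (MvPolynomial.X j : MvPolynomial (Fin n) k) ∈ polyGrading n k (-1) :=
    MvPolynomial.isWeightedHomogeneous_X k (fun _ : Fin n => (-1 : ℤ)) j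
  induction hm using Submodule.iSup_induction' with
  | mem l x hx =>
    rw [M.proj_of_mem hx, M.proj_of_mem (M.smul_mem _ _ _ _ hX hx)]
    by_cases h : l = i + 1
    · rw [if_pos h, if_pos (by omega)]
    · rw [if_neg h, if_neg (by omega), smul_zero]
  | zero => simp
  | add x y _ _ hx hy => rw [smul_add, map_add, map_add, smul_add, hx, hy]

theorem toFiber_proj_eq_zero {m : M.carrier} (hm : M.toFiber m = 0) (i : ℤ) :
    M.toFiber (M.proj i m) = 0 := by
  have key : ∀ r ∈ augIdeal n k, ∀ (m : M.carrier) (i : ℤ), M.proj i (r • m) ∈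
      augIdeal n k • (⊤ : Submodule (MvPolynomial (Fin n) k) M.carrier) := by
    intro r hr
    induction hr using Submodule.span_induction with
    | mem x hx =>
      obtain ⟨j, rfl⟩ := hx
      intro m i
      rw [proj_X_smul]
      exact Submodule.smul_mem_smul (Ideal.subset_span ⟨j, rfl⟩) trivial
    | zero => intro m i; simp
    | add x y _ _ hx hy =>
      intro m i
      rw [add_smul, map_add]
      exact add_mem (hx m i) (hy m i)
    | smul a x _ hx =>
      intro m i
      rw [smul_eq_mul, mul_comm, mul_smul]
      exact hx (a • m) i
  rw [toFiber_eq_zero_iff] at hm ⊢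
  induction hm using Submodule.smul_induction_on' with
  | smul r hr x _ => exact key r hr x i
  | add x _ y _ hx hy => rw [map_add]; exact add_mem hx hy

theorem fiberGrading_isInternal : DirectSum.IsInternal M.fiberGrading := by
  apply DirectSum.isInternal_submodule_of_iSupIndep_of_iSup_eq_top
  · intro i
    rw [Submodule.disjoint_def]
    rintro _ ⟨m, hm, rfl⟩ h
    simp only [fiberGrading, ← Submodule.map_iSup] at h
    obtain ⟨y, hy, hym⟩ := h
    have hle : (⨆ j, ⨆ (_ : j ≠ i), M.grading j) ≤ LinearMap.ker (M.proj i) := by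
      refine iSup₂_le fun j hj x hx => ?_
      rw [LinearMap.mem_ker, M.proj_of_mem hx, if_neg hj]
    have h0 : M.toFiber (m - y) = 0 := by rw [map_sub, hym, sub_self]
    have h1 := M.toFiber_proj_eq_zero h0 i
    rwa [map_sub, LinearMap.mem_ker.1 (hle hy), sub_zero, M.proj_of_mem hm, if_pos rfl] at h1
  · change ⨆ i, (M.grading i).map M.toFiber = ⊤
    rw [← Submodule.map_iSup, M.isInternal.submodule_iSup_eq_top, Submodule.map_top, LinearMap.range_eq_top]
    exact M.toFiber_surjective

/-- The `p`-complex `M ⊗_A k` of `k`-vector spaces. -/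
def fiber : NComplex.{u, max v u} p k where
  carrier := M.Fiber
  grading := M.fiberGrading
  isInternal := M.fiberGrading_isInternal
  d := M.fiberD
  d_mem := by
    rintro i _ ⟨m, hm, rfl⟩
    exact ⟨M.d m, M.d_mem i m hm, rfl⟩
  d_pow := by
    have h : ∀ (l : ℕ) (m : M.carrier), (M.fiberD ^ l) (M.toFiber m) = M.toFiber ((M.d ^ l) m) := by
      intro l
      induction l with
      | zero => intro m; rfl
      | succ l ih =>
        intro m
        rw [pow_succ, pow_succ, Module.End.mul_apply, Module.End.mul_apply, ← ih]
        rfl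
    ext t
    obtain ⟨m, rfl⟩ := M.toFiber_surjective t
    rw [h, M.d_pow]
    simp

end PDGModule

/-- The set of all values of `∑ i, dim ₁H_i(M ⊗_A k)`, where `M` ranges over the finitely
generated, free `p`-DG modules over `A = k[x_1, …, x_n]` such that `ₛH_•(M ⊗_A k)` is nonzero and
`ₛH_•(M)` is finite-dimensional for all `1 ≤ s ≤ p - 1`. -/
def fiberHomologyDims (p n : ℕ) (k : Type u) [Field k] : Set ℕ∞ :=
  {D | ∃ M : PDGModule.{u, u} p n k, M.IsFree ∧ M.IsFG ∧
    (∀ s : ℕ, 1 ≤ s → s ≤ p - 1 → Nontrivial (M.fiber.totalHomology s)) ∧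
    (∀ s : ℕ, 1 ≤ s → s ≤ p - 1 → Module.Finite k (M.toNComplex.totalHomology s)) ∧
    D = M.fiber.homologyDim 1}

/-- The group ring `k[G]` of `G = (ℤ/p)^n`. -/
abbrev ElemAbGroupRing (p n : ℕ) (k : Type u) [Field k] : Type u :=
  MonoidAlgebra k (Multiplicative (Fin n → ZMod p))

/-- A perfect chain complex: a bounded complex of finitely generated projective modules. -/
def IsPerfectComplex {R : Type u} [Ring R] (C : ChainComplex (ModuleCat.{v} R) ℤ) : Prop :=
  (∃ a b : ℤ, ∀ i : ℤ, i < a ∨ b < i → CategoryTheory.Limits.IsZero (C.X i)) ∧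
    ∀ i : ℤ, Module.Finite R (C.X i) ∧ Module.Projective R (C.X i)

/-- The sum over all integers `i` of the `k`-dimensions of the homology modules `H_i(C)` of a chain
complex `C` of modules over a `k`-algebra `R`. -/
def chainHomologyDim (k : Type u) [Field k] {R : Type u} [Ring R] [Algebra k R]
    (C : ChainComplex (ModuleCat.{v} R) ℤ) : ℕ∞ :=
  ∑' i : ℤ, eDim k ((ModuleCat.restrictScalars (algebraMap k R)).obj (C.homology i))

end

/-! A non-acyclic perfect complex `C` is turned into an admissible `p`-DG module whose fiber has no
more homology than `C`; the bound follows by taking the infimum. The complex `k[G]` in degree `0`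
shows that some admissible value is finite, and since `ℕ∞` is well-ordered the infimum is an
attained natural number.

The construction has two steps. First, `C` is stretched to a `p`-complex `V`: each module of odd
degree is repeated `p - 1` times with identity maps in between, so that `p` consecutive maps contain
two differentials of `C` and compose to zero. Every `ₛH(V)` still sees the homology of `C`, and
`₁H(V)` is no larger than it. Second, the elements `yᵢ = gᵢ - 1` act on `V` as commuting
`p`-nilpotent maps, so in characteristic `p` the map `D = d + ∑ xᵢ yᵢ` on `A ⊗ V` satisfies `D ^ p =
0`. Setting all `xᵢ` to zero gives back `V`.

The core is that `ₛH(A ⊗ V)` is finite-dimensional, for which it suffices that a power of each `xᵢ`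
annihilates it (`exists_pow_smul_mem_range`). Projectivity gives a homotopy `h` with `∑ yᵢᵃ h
yᵢᵖ⁻¹⁻ᵃ = 1` that commutes with the other `yⱼ` (`exists_homotopy_nilAct`). The operator `w = ∑ Dᵃ h
Dᵖ⁻¹⁻ᵃ` commutes with `D` and sends `ker Dˢ` into `im Dᵖ⁻ˢ`. In characteristic `p` this sum is an
iterated commutator, hence blind to the summands `xⱼ yⱼ` with `j ≠ i`; so `w` equals `xᵢᵖ⁻¹` up to
terms lowering the degree filtration of `V`. As that filtration is finite, a power of `xᵢ` acts by
zero on homology. -/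

noncomputable section

/-! ### Iterated commutators in characteristic `p` -/

section CharacteristicP

/-- Neighbouring entries of row `p - 1` of Pascal's triangle add up to an inner entry of row `p`,
which is divisible by `p`; so the signs alternate. -/
theorem cast_choose_pred_prime {R : Type*} [Ring R] (p : ℕ) [hp : Fact p.Prime]
    (h0 : (p : R) = 0) (a : ℕ) (ha : a < p) : (((p - 1).choose a : ℕ) : R) = (-1) ^ a := by
  induction a with
  | zero => simp
  | succ a ih =>
    have h1 : p.choose (a + 1) = (p - 1).choose a + (p - 1).choose (a + 1) := by
      obtain ⟨q, rfl⟩ : ∃ q, p = q + 1 := ⟨p - 1, by have := hp.1.pos; omega⟩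
      rfl
    obtain ⟨c, hc⟩ : p ∣ p.choose (a + 1) := hp.1.dvd_choose_self (by omega) ha
    have h2 : ((p.choose (a + 1) : ℕ) : R) = 0 := by rw [hc, Nat.cast_mul, h0, zero_mul]
    rw [h1, Nat.cast_add, ih (by omega)] at h2
    rw [pow_succ, mul_neg_one]
    exact eq_neg_of_add_eq_zero_right h2

/-- In characteristic `p`, the sum `∑ xⁱ yᵖ⁻¹⁻ⁱ` of commuting elements is `(x - y)ᵖ⁻¹`. -/
theorem Commute.geom_sum_eq_sub_pow {R : Type*} [Ring R] (p : ℕ) [hp : Fact p.Prime]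
    (h0 : (p : R) = 0) {x y : R} (h : Commute x y) :
    ∑ i ∈ Finset.range p, x ^ i * y ^ (p - 1 - i) = (x - y) ^ (p - 1) := by
  have hpos := hp.1.pos
  have hsign : (-1 : R) ^ (p - 1) = 1 := by
    rw [← cast_choose_pred_prime p h0 (p - 1) (by omega), Nat.choose_self, Nat.cast_one]
  rw [sub_eq_add_neg, h.neg_right.add_pow, Nat.sub_add_cancel hpos]
  refine Finset.sum_congr rfl fun i hi => ?_
  have hi := Finset.mem_range.1 hi
  rw [cast_choose_pred_prime p h0 i hi, neg_pow y, mul_assoc, mul_assoc,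
    ((Commute.neg_one_left (y ^ (p - 1 - i))).pow_left i).symm.eq, ← mul_assoc ((-1) ^ _),
    ← pow_add, Nat.sub_add_cancel (by omega), hsign, one_mul]

/-- The sum `∑ xⁱ h xᵖ⁻¹⁻ⁱ`; in characteristic `p` it is the `(p-1)`-st iterated commutator. -/
def contraction {R : Type*} [Ring R] (p : ℕ) (x h : R) : R :=
  ∑ i ∈ Finset.range p, x ^ i * h * x ^ (p - 1 - i)

/-- Left and right multiplication by `x` commute, so `Commute.geom_sum_eq_sub_pow` applies to them
in the endomorphism ring. -/
theorem contraction_eq_sub_pow {R : Type*} [Ring R] (p : ℕ) [hp : Fact p.Prime]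
    (h0 : (p : R) = 0) (x h : R) :
    contraction p x h =
      ((LinearMap.mulLeft ℤ x - LinearMap.mulRight ℤ x : Module.End ℤ R) ^ (p - 1)) h := by
  have h0' : (p : Module.End ℤ R) = 0 := by
    ext r
    rw [← nsmul_one, LinearMap.smul_apply, Module.End.one_apply, nsmul_eq_mul, h0, zero_mul]
    rfl
  have hc : Commute (LinearMap.mulLeft ℤ x : Module.End ℤ R) (LinearMap.mulRight ℤ x) :=
    LinearMap.ext fun r => (mul_assoc x r x).symm
  rw [← hc.geom_sum_eq_sub_pow p h0', LinearMap.sum_apply]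
  refine Finset.sum_congr rfl fun i _ => ?_
  rw [Module.End.mul_apply, LinearMap.pow_mulLeft, LinearMap.pow_mulRight,
    LinearMap.mulLeft_apply, LinearMap.mulRight_apply, mul_assoc]

/-- Adding to `x` an element that commutes with everything does not change the contraction. -/
theorem contraction_add {R : Type*} [Ring R] (p : ℕ) [hp : Fact p.Prime]
    (h0 : (p : R) = 0) {x e h : R} (hx : Commute e x) (hh : Commute e h) :
    contraction p (x + e) h = contraction p x h := by
  rw [contraction_eq_sub_pow p h0, contraction_eq_sub_pow p h0]
  -- The induction must also carry that `e` commutes with each iterated commutator; otherwise `e`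
  -- does not cancel in the next one.
  suffices H : ∀ j : ℕ,
      ((LinearMap.mulLeft ℤ (x + e) - LinearMap.mulRight ℤ (x + e) : Module.End ℤ R) ^ j) h =
        ((LinearMap.mulLeft ℤ x - LinearMap.mulRight ℤ x : Module.End ℤ R) ^ j) h ∧
      Commute e (((LinearMap.mulLeft ℤ x - LinearMap.mulRight ℤ x : Module.End ℤ R) ^ j) h) from
    (H _).1
  intro j
  induction j with
  | zero => exact ⟨rfl, hh⟩
  | succ j ih =>
    rw [pow_succ', pow_succ', Module.End.mul_apply, Module.End.mul_apply, ih.1]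
    simp only [LinearMap.sub_apply, LinearMap.mulLeft_apply, LinearMap.mulRight_apply]
    refine ⟨?_, (hx.mul_right ih.2).sub_right (ih.2.mul_right hx)⟩
    rw [add_mul, mul_add, ih.2.eq]
    abel

theorem contraction_smul {A R : Type*} [CommRing A] [Ring R] [Algebra A R] {p : ℕ}
    (a : A) (x h : R) : contraction p (a • x) h = a ^ (p - 1) • contraction p x h := by
  rw [contraction, contraction, Finset.smul_sum]
  refine Finset.sum_congr rfl fun i hi => ?_
  have hi := Finset.mem_range.1 hi
  rw [smul_pow, smul_pow, smul_mul_assoc, smul_mul_assoc, mul_smul_comm, smul_smul, ← pow_add,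
    show i + (p - 1 - i) = p - 1 by omega]

/-- The commutator of `x` with the sum telescopes to `xᵖ h - h xᵖ`. -/
theorem commute_contraction {R : Type*} [Ring R] {p : ℕ} {x : R} (h : R) (hx : x ^ p = 0) :
    Commute x (contraction p x h) := by
  have key : ∀ n : ℕ, x * contraction n x h - contraction n x h * x = x ^ n * h - h * x ^ n := by
    intro n
    rw [contraction, Finset.mul_sum, Finset.sum_mul, ← Finset.sum_sub_distrib]
    have := Finset.sum_range_sub (fun i => x ^ i * h * x ^ (n - i)) n
    simp only [Nat.sub_self, pow_zero, mul_one, one_mul, Nat.sub_zero] at this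
    rw [← this]
    refine Finset.sum_congr rfl fun i hi => ?_
    have hi := Finset.mem_range.1 hi
    rw [mul_assoc _ _ x, ← pow_succ, ← mul_assoc x, ← mul_assoc x, ← pow_succ',
      show n - 1 - i = n - (i + 1) by omega, show n - (i + 1) + 1 = n - i by omega]
  have := key p
  rw [hx, zero_mul, mul_zero, sub_zero] at this
  exact sub_eq_zero.1 this

end CharacteristicP

/-! ### Annihilating the homology by powers of a scalar -/

section Annihilation

variable {A E : Type*} [CommRing A] [AddCommGroup E] [Module A E]

/-- In each term either the inner exponent `p - 1 - i` is at least `s`, which kills `z`, or the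
outer exponent `i` is at least `p - s`. -/
theorem contraction_apply_mem_range {p s : ℕ} (D h : Module.End A E) (hs : s ≤ p) {z : E}
    (hz : (D ^ s) z = 0) : contraction p D h z ∈ LinearMap.range (D ^ (p - s)) := by
  rw [contraction, LinearMap.sum_apply]
  refine Submodule.sum_mem _ fun i hi => ?_
  have hi := Finset.mem_range.1 hi
  by_cases h1 : s ≤ p - 1 - i
  · have : (D ^ (p - 1 - i)) z = 0 := by
      obtain ⟨t, ht⟩ := Nat.exists_eq_add_of_le' h1
      rw [ht, pow_add, Module.End.mul_apply, hz, map_zero]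
    rw [Module.End.mul_apply, this, map_zero]
    exact zero_mem _
  · obtain ⟨t, ht⟩ : ∃ t, i = (p - s) + t := ⟨i - (p - s), by omega⟩
    exact ⟨(D ^ t) (h ((D ^ (p - 1 - i)) z)), by
      rw [← Module.End.mul_apply, ← pow_add, ← ht]; rfl⟩

/-- Let `D = δ + x y + e` be a `p`-differential, where `δ` lowers a finite filtration and `y`, `e`
preserve it. If `y` is contractible by a homotopy that preserves the filtration and commutes with
`e`, then a power of `x` annihilates the homology of `D`. -/
theorem exists_pow_smul_mem_range {p : ℕ} [hp : Fact p.Prime] (h0 : (p : A) = 0)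
    (F : ℕ → Submodule A E) (L : ℕ) (hbot : F 0 = ⊥) (htop : F L = ⊤)
    (hmono : ∀ j, F j ≤ F (j + 1)) (x : A) {δ y e h : Module.End A E}
    (hδ : ∀ j, ∀ z ∈ F (j + 1), δ z ∈ F j) (hy : ∀ j, ∀ z ∈ F j, y z ∈ F j)
    (he : ∀ j, ∀ z ∈ F j, e z ∈ F j) (hh : ∀ j, ∀ z ∈ F j, h z ∈ F j)
    (hey : Commute e y) (heh : Commute e h) (hc : contraction p y h = 1)
    (hD : (δ + (x • y + e)) ^ p = 0) :
    ∃ N : ℕ, ∀ s ≤ p, ∀ z : E, ((δ + (x • y + e)) ^ s) z = 0 →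
      x ^ N • z ∈ LinearMap.range ((δ + (x • y + e)) ^ (p - s)) := by
  set D₀ : Module.End A E := x • y + e with hD₀
  set D : Module.End A E := δ + D₀ with hDdef
  have h0' : (p : Module.End A E) = 0 := by
    ext r
    rw [← nsmul_one, LinearMap.smul_apply, Module.End.one_apply, ← Nat.cast_smul_eq_nsmul A, h0,
      zero_smul]
    rfl
  have hδ' : ∀ j, ∀ z ∈ F j, δ z ∈ F j := by
    rintro (_ | j) z hz
    · rw [hbot, Submodule.mem_bot] at hz
      rw [hz, map_zero]; exact zero_mem _
    · exact hmono j (hδ j z hz)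
  have hD₀F : ∀ j, ∀ z ∈ F j, D₀ z ∈ F j := fun j z hz =>
    add_mem (Submodule.smul_mem _ _ (hy j z hz)) (he j z hz)
  have hDF : ∀ j, ∀ z ∈ F j, D z ∈ F j := fun j z hz => add_mem (hδ' j z hz) (hD₀F j z hz)
  have powF : ∀ (f : Module.End A E), (∀ j, ∀ z ∈ F j, f z ∈ F j) →
      ∀ i j, ∀ z ∈ F j, (f ^ i) z ∈ F j := by
    intro f hf i
    induction i with
    | zero => intro j z hz; exact hz
    | succ i ih => intro j z hz; rw [pow_succ', Module.End.mul_apply]; exact hf _ _ (ih j z hz)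
  -- The powers of `D` and `D₀` agree on the associated graded module, since `δ` vanishes there.
  have hpow : ∀ i j, ∀ z ∈ F (j + 1), (D ^ i) z - (D₀ ^ i) z ∈ F j := by
    intro i
    induction i with
    | zero => intro j z _; simp
    | succ i ih =>
      intro j z hz
      have : (D ^ (i + 1)) z - (D₀ ^ (i + 1)) z =
          δ ((D ^ i) z) + D₀ ((D ^ i) z - (D₀ ^ i) z) := by
        rw [pow_succ', pow_succ', Module.End.mul_apply, Module.End.mul_apply, map_sub, hDdef,
          LinearMap.add_apply]
        abel
      rw [this]
      exact add_mem (hδ j _ (powF D hDF i _ z hz)) (hD₀F j _ (ih j z hz))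
  set w : Module.End A E := contraction p D h with hw
  have hcomm : Commute D w := commute_contraction h hD
  -- The summand `e` drops out, the scalar `x` comes out `p - 1` times, and the contraction of `y`
  -- is `1`.
  have hlead : contraction p D₀ h = x ^ (p - 1) • (1 : Module.End A E) := by
    have h1 : Commute e (x • y) := hey.smul_right x
    rw [hD₀, contraction_add p h0' h1 heh, contraction_smul, hc]
  have hν : ∀ j, ∀ z ∈ F (j + 1), w z - x ^ (p - 1) • z ∈ F j := by
    intro j z hz
    have : w z - x ^ (p - 1) • z = contraction p D h z - contraction p D₀ h z := by
      rw [hlead]; rfl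
    rw [this, contraction, contraction, LinearMap.sum_apply, LinearMap.sum_apply,
      ← Finset.sum_sub_distrib]
    refine Submodule.sum_mem _ fun i _ => ?_
    simp only [Module.End.mul_apply]
    set b := p - 1 - i
    have : (D ^ i) (h ((D ^ b) z)) - (D₀ ^ i) (h ((D₀ ^ b) z)) =
        ((D ^ i) (h ((D ^ b) z)) - (D₀ ^ i) (h ((D ^ b) z))) +
          (D₀ ^ i) (h ((D ^ b) z - (D₀ ^ b) z)) := by
      rw [map_sub, map_sub]; abel
    rw [this]
    exact add_mem (hpow i j _ (hh _ _ (powF D hDF b _ z hz)))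
      (powF D₀ hD₀F i _ _ (hh _ _ (hpow b j z hz)))
  -- Each filtration step costs a factor `x ^ (p - 1)`: the cycle `w z - x ^ (p - 1) • z` lies one
  -- step lower, and `w z` is already in the required image.
  refine ⟨(p - 1) * L, fun s hs => ?_⟩
  suffices H : ∀ j, ∀ z ∈ F j, (D ^ s) z = 0 →
      x ^ ((p - 1) * j) • z ∈ LinearMap.range (D ^ (p - s)) from
    fun z hz => H L z (htop ▸ Submodule.mem_top) hz
  intro j
  induction j with
  | zero =>
    intro z hz _
    rw [hbot, Submodule.mem_bot] at hz
    rw [hz, smul_zero]; exact zero_mem _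
  | succ j ih =>
    intro z hz hzs
    have h1 : (D ^ s) (w z - x ^ (p - 1) • z) = 0 := by
      rw [map_sub, map_smul, hzs, smul_zero, sub_zero, ← Module.End.mul_apply,
        (hcomm.pow_left s).eq, Module.End.mul_apply, hzs, map_zero]
    have h2 := ih _ (hν j z hz) h1
    have h3 := Submodule.smul_mem _ (x ^ ((p - 1) * j))
      (contraction_apply_mem_range D h hs hzs)
    have h4 := sub_mem h3 h2
    rwa [← smul_sub, sub_sub_cancel, smul_smul, ← pow_add, ← Nat.mul_succ] at h4

end Annihilation

/-! ### The contracting homotopy on the group ring -/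

section GroupRing

variable (p n : ℕ) [hp : Fact p.Prime] (k : Type u) [Field k]

/-- The `i`-th standard generator of `(ℤ/p)^n`, as an element of the group ring. -/
def groupGen (i : Fin n) : ElemAbGroupRing p n k :=
  MonoidAlgebra.single (Multiplicative.ofAdd (Pi.single i 1)) 1

/-- The nilpotent element `gᵢ - 1` of the group ring. -/
def nilGen (i : Fin n) : ElemAbGroupRing p n k := groupGen p n k i - 1

instance [CharP k p] : CharP (ElemAbGroupRing p n k) p :=
  charP_of_injective_algebraMap (algebraMap k (ElemAbGroupRing p n k)).injective p

theorem groupGen_pow (i : Fin n) : groupGen p n k i ^ p = 1 := by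
  rw [groupGen, MonoidAlgebra.single_pow, one_pow, ← ofAdd_nsmul, ← Pi.single_smul]
  simp [MonoidAlgebra.one_def]

theorem nilGen_pow [CharP k p] (i : Fin n) : nilGen p n k i ^ p = 0 := by
  rw [nilGen, sub_pow_char, groupGen_pow, one_pow, sub_self]

/-- The linear endomorphism of the group ring that multiplies a group element `v` by `gᵢ` if
`vᵢ = -1` and annihilates it otherwise. -/
def groupHomotopy (i : Fin n) : ElemAbGroupRing p n k →ₗ[k] ElemAbGroupRing p n k :=
  (MonoidAlgebra.basis _ k).constr k fun v =>
    if v.toAdd i = -1 then MonoidAlgebra.single (v * Multiplicative.ofAdd (Pi.single i 1)) 1 else 0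

theorem groupHomotopy_single (i : Fin n) (v : Multiplicative (Fin n → ZMod p)) :
    groupHomotopy p n k i (MonoidAlgebra.single v 1) = if v.toAdd i = -1 then
      MonoidAlgebra.single (v * Multiplicative.ofAdd (Pi.single i 1)) 1 else 0 := by
  have : (MonoidAlgebra.single v 1 : ElemAbGroupRing p n k) = MonoidAlgebra.basis _ k v := by simp
  rw [this, groupHomotopy, Module.Basis.constr_basis]

/-- Multiplying by `gⱼ` leaves the `i`-th coordinate unchanged, and that coordinate alone decides
what the homotopy does. -/
theorem groupHomotopy_mul (i j : Fin n) (hij : j ≠ i) (r : ElemAbGroupRing p n k) :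
    groupHomotopy p n k i (groupGen p n k j * r) =
      groupGen p n k j * groupHomotopy p n k i r := by
  suffices H : groupHomotopy p n k i ∘ₗ LinearMap.mulLeft k (groupGen p n k j) =
      LinearMap.mulLeft k (groupGen p n k j) ∘ₗ groupHomotopy p n k i from
    LinearMap.congr_fun H r
  refine (MonoidAlgebra.basis _ k).ext fun v => ?_
  simp only [MonoidAlgebra.basis_apply, LinearMap.comp_apply, LinearMap.mulLeft_apply, groupGen,
    MonoidAlgebra.single_mul_single, mul_one, groupHomotopy_single, toAdd_mul, toAdd_ofAdd,
    Pi.add_apply, Pi.single_eq_of_ne hij.symm, zero_add]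
  split_ifs
  · rw [MonoidAlgebra.single_mul_single, mul_one, mul_assoc]
  · rw [mul_zero]

theorem groupHomotopy_sum (i : Fin n) (r : ElemAbGroupRing p n k) :
    ∑ a ∈ Finset.range p, groupGen p n k i ^ a *
      groupHomotopy p n k i (groupGen p n k i ^ (p - 1 - a) * r) = r := by
  suffices H : ∑ a ∈ Finset.range p, LinearMap.mulLeft k (groupGen p n k i ^ a) ∘ₗ
      groupHomotopy p n k i ∘ₗ LinearMap.mulLeft k (groupGen p n k i ^ (p - 1 - a)) =
      LinearMap.id by
    have := LinearMap.congr_fun H r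
    rw [LinearMap.sum_apply] at this
    exact this
  refine (MonoidAlgebra.basis _ k).ext fun v => ?_
  have hpow : ∀ a : ℕ, groupGen p n k i ^ a =
      MonoidAlgebra.single (Multiplicative.ofAdd (Pi.single i (a : ZMod p))) 1 := by
    intro a
    rw [groupGen, MonoidAlgebra.single_pow, one_pow, ← ofAdd_nsmul, ← Pi.single_smul]
    simp
  -- The homotopy is nonzero only if `p - 1 - a + vᵢ = -1` in `ℤ/p`, that is `a = vᵢ`. In that term
  -- `gᵢ` is applied `p` times in all, which returns `v`.
  rw [LinearMap.sum_apply, Finset.sum_eq_single (v.toAdd i).val]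
  · have hlt := ZMod.val_lt (v.toAdd i)
    have hcast : ((p - 1 - (v.toAdd i).val : ℕ) : ZMod p) + v.toAdd i = -1 := by
      rw [Nat.cast_sub (by omega), Nat.cast_sub hp.1.pos]
      simp
    simp only [MonoidAlgebra.basis_apply, LinearMap.comp_apply, LinearMap.mulLeft_apply, hpow,
      MonoidAlgebra.single_mul_single, mul_one, groupHomotopy_single, toAdd_mul, toAdd_ofAdd,
      Pi.add_apply, Pi.single_eq_same, hcast, if_true, LinearMap.id_apply]
    congr 1
    apply Multiplicative.toAdd.injective
    simp only [toAdd_mul, toAdd_ofAdd]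
    have h1 : (Pi.single i (((v.toAdd i).val : ℕ) : ZMod p) : Fin n → ZMod p) +
        (Pi.single i ((p - 1 - (v.toAdd i).val : ℕ) : ZMod p) + v.toAdd + Pi.single i 1) =
        v.toAdd + (Pi.single i (((v.toAdd i).val : ℕ) : ZMod p) +
          Pi.single i ((p - 1 - (v.toAdd i).val : ℕ) : ZMod p) + Pi.single i 1) := by abel
    rw [h1, ← Pi.single_add, ← Pi.single_add]
    have h2 : (((v.toAdd i).val : ℕ) : ZMod p) + ((p - 1 - (v.toAdd i).val : ℕ) : ZMod p) + 1
        = 0 := by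
      rw [ZMod.natCast_zmod_val, add_comm (v.toAdd i), hcast]; ring
    rw [h2, Pi.single_zero, add_zero]
  · intro a ha hne
    have ha := Finset.mem_range.1 ha
    simp only [MonoidAlgebra.basis_apply, LinearMap.comp_apply, LinearMap.mulLeft_apply, hpow,
      MonoidAlgebra.single_mul_single, mul_one, groupHomotopy_single, toAdd_mul, toAdd_ofAdd,
      Pi.add_apply, Pi.single_eq_same]
    rw [if_neg, mul_zero]
    intro h
    apply hne
    have h3 : v.toAdd i = (a : ZMod p) := by
      rw [Nat.cast_sub (by omega), Nat.cast_sub hp.1.pos] at h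
      simp only [CharP.cast_eq_zero, Nat.cast_one, zero_sub] at h
      linear_combination h
    rw [h3, ZMod.val_cast_of_lt ha]
  · intro h
    exact absurd (Finset.mem_range.2 (ZMod.val_lt _)) h

end GroupRing

/-! ### The contracting homotopy on projective modules -/

section Projective

variable (p : ℕ) {n : ℕ} [hp : Fact p.Prime] (k : Type u) [Field k]
  (P : Type v) [AddCommGroup P] [Module k P] [Module (ElemAbGroupRing p n k) P]
  [IsScalarTower k (ElemAbGroupRing p n k) P]

/-- The action of `gᵢ - 1` on a module over the group ring. -/
def nilAct (i : Fin n) : Module.End k P := Algebra.lsmul k k P (nilGen p n k i)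

@[simp] theorem nilAct_apply (i : Fin n) (x : P) :
    nilAct p k P i x = nilGen p n k i • x := rfl

theorem nilAct_commute (i j : Fin n) :
    Commute (nilAct p k P i) (nilAct p k P j) :=
  (Commute.all (nilGen p n k i) (nilGen p n k j)).map (Algebra.lsmul k k P)

theorem nilAct_pow [CharP k p] (i : Fin n) : nilAct p k P i ^ p = 0 := by
  rw [nilAct, ← map_pow, nilGen_pow, map_zero]

/-- A projective module is a retract of a free one by maps linear over the group ring; the homotopy
on the free module, applied coordinatewise, is transported along the retraction. -/
theorem exists_homotopy_nilAct [CharP k p] [Module.Projective (ElemAbGroupRing p n k) P] (i : Fin n) :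
    ∃ h : Module.End k P, contraction p (nilAct p k P i) h = 1 ∧
      ∀ j, j ≠ i → Commute (nilAct p k P j) h := by
  obtain ⟨s, hs⟩ := Module.projective_def.1
    (inferInstance : Module.Projective (ElemAbGroupRing p n k) P)
  let l := Finsupp.linearCombination (ElemAbGroupRing p n k) (id : P → P)
  let f : (P →₀ ElemAbGroupRing p n k) →ₗ[k] (P →₀ ElemAbGroupRing p n k) :=
    Finsupp.mapRange.linearMap (groupHomotopy p n k i)
  let h : Module.End k P := l.restrictScalars k ∘ₗ f ∘ₗ s.restrictScalars k
  have hh : ∀ x, h x = l (f (s x)) := fun x => rfl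
  have h0 : (p : Module.End k P) = 0 := by
    rw [← map_natCast (algebraMap k (Module.End k P)), CharP.cast_eq_zero, map_zero]
  have hg : ∀ j, nilAct p k P j =
      Algebra.lsmul k k P (groupGen p n k j) + (-1 : Module.End k P) := by
    intro j
    rw [nilAct, nilGen, map_sub, map_one, sub_eq_add_neg]
  refine ⟨h, ?_, fun j hj => ?_⟩
  -- The contraction ignores the central summand `-1`, so `gᵢ - 1` may be replaced by `gᵢ`.
  · rw [hg, contraction_add p h0 (Commute.neg_one_left _) (Commute.neg_one_left _)]
    ext x
    rw [contraction, LinearMap.sum_apply, Module.End.one_apply]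
    have : ∀ a, ((Algebra.lsmul k k P (groupGen p n k i)) ^ a * h *
        (Algebra.lsmul k k P (groupGen p n k i)) ^ (p - 1 - a)) x =
        l (groupGen p n k i ^ a • f (groupGen p n k i ^ (p - 1 - a) • s x)) := by
      intro a
      rw [← map_pow, ← map_pow, Module.End.mul_apply, Module.End.mul_apply]
      change groupGen p n k i ^ a • h (groupGen p n k i ^ (p - 1 - a) • x) = _
      rw [hh, s.map_smul, l.map_smul]
    rw [Finset.sum_congr rfl fun a _ => this a, ← map_sum]
    refine Eq.trans ?_ (hs x)
    congr 1
    ext1 q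
    rw [Finsupp.finsetSum_apply]
    exact groupHomotopy_sum p n k i (s x q)
  · rw [hg]
    refine Commute.add_left ?_ (Commute.neg_one_left _)
    refine LinearMap.ext fun x => ?_
    change groupGen p n k j • h x = h (groupGen p n k j • x)
    rw [hh, hh, s.map_smul, ← l.map_smul]
    congr 1
    ext1 q
    exact (groupHomotopy_mul p n k i j hj (s x q)).symm

end Projective

/-! ### The `p`-DG module `A ⊗ V` and its fiber -/

/-- A `p`-complex of vector spaces with commuting `p`-nilpotent chain endomorphisms
`y₁, …, yₙ` of degree `0`. -/
structure NilpotentActionComplex (p n : ℕ) (k : Type u) [Field k] extends NComplex.{u, u} p k where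
  y : Fin n → carrier →ₗ[k] carrier
  y_mem : ∀ (j : Fin n) (i : ℤ) (x : carrier), x ∈ grading i → y j x ∈ grading i
  y_comm : ∀ i j, Commute (y i) (y j)
  d_comm : ∀ i, Commute d (y i)
  y_pow : ∀ i, y i ^ p = 0

namespace NilpotentActionComplex

variable {p n : ℕ} {k : Type u} [Field k] (V : NilpotentActionComplex p n k)

/-- The polynomial ring tensored with the underlying vector space. -/
abbrev Ext : Type u := MvPolynomial (Fin n) k ⊗[k] V.carrier

/-- The total degree on `A ⊗ V`. -/
def extGrading (i : ℤ) : Submodule k V.Ext :=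
  Submodule.span k {t | ∃ (a b : ℤ) (f : MvPolynomial (Fin n) k) (v : V.carrier),
    f ∈ polyGrading n k a ∧ v ∈ V.grading b ∧ a + b = i ∧ f ⊗ₜ[k] v = t}

theorem tmul_mem_extGrading {a b i : ℤ} {f : MvPolynomial (Fin n) k} {v : V.carrier}
    (hf : f ∈ polyGrading n k a) (hv : v ∈ V.grading b) (h : a + b = i) :
    f ⊗ₜ[k] v ∈ V.extGrading i :=
  Submodule.subset_span ⟨a, b, f, v, hf, hv, h, rfl⟩

/-- A basis of `V` consisting of homogeneous elements. -/
def homBasis : Module.Basis (Σ i : ℤ, Module.Basis.ofVectorSpaceIndex k (V.grading i)) k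
    V.carrier :=
  V.isInternal.collectedBasis fun i => Module.Basis.ofVectorSpace k (V.grading i)

theorem homBasis_mem (j : Σ i : ℤ, Module.Basis.ofVectorSpaceIndex k (V.grading i)) :
    V.homBasis j ∈ V.grading j.1 :=
  V.isInternal.collectedBasis_mem _ j

/-- Monomials tensored with a homogeneous basis of `V` form a basis; elements of different total
degree have disjoint supports in it. -/
theorem extGrading_isInternal : DirectSum.IsInternal V.extGrading := by
  classical
  apply DirectSum.isInternal_submodule_of_iSupIndep_of_iSup_eq_top
  · let B := (MvPolynomial.basisMonomials (Fin n) k).tensorProduct V.homBasis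
    let S : ℤ → Set ((Fin n →₀ ℕ) × (Σ i : ℤ, Module.Basis.ofVectorSpaceIndex k (V.grading i))) :=
      fun i => {q | Finsupp.weight (fun _ : Fin n => (-1 : ℤ)) q.1 + q.2.1 = i}
    let T : ℤ → Submodule k V.Ext := fun i =>
      (Finsupp.supported k k (S i)).comap B.repr.toLinearMap
    have hle : ∀ i, V.extGrading i ≤ T i := by
      intro i
      refine Submodule.span_le.2 ?_
      rintro _ ⟨a, b, f, v, hf, hv, hab, rfl⟩
      change B.repr (f ⊗ₜ v) ∈ Finsupp.supported k k (S i)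
      rw [Finsupp.mem_supported']
      rintro ⟨m, c⟩ hmc
      rw [Module.Basis.tensorProduct_repr_tmul_apply, smul_eq_mul]
      by_contra hne
      apply hmc
      have h1 : f.coeff m ≠ 0 := fun h => hne (mul_eq_zero_of_right _ h)
      have h2 : V.homBasis.repr v c ≠ 0 := left_ne_zero_of_mul hne
      have h3 : Finsupp.weight (fun _ : Fin n => (-1 : ℤ)) m = a := hf h1
      have h4 : b = c.1 := by
        by_contra h
        exact h2 (V.isInternal.collectedBasis_repr_of_mem_ne _ h hv)
      change Finsupp.weight _ m + c.1 = i
      rw [h3, ← h4, hab]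
    refine iSupIndep.mono (fun i => ?_) hle
    have h1 : (⨆ j, ⨆ (_ : j ≠ i), T j) ≤
        (Finsupp.supported k k (S i)ᶜ).comap B.repr.toLinearMap := by
      refine iSup₂_le fun j hj => Submodule.comap_mono (Finsupp.supported_mono ?_)
      intro q hq hq'
      exact hj (hq.symm.trans hq')
    refine Disjoint.mono_right h1 ?_
    rw [Submodule.disjoint_def]
    intro t ht ht'
    have := (Finsupp.disjoint_supported_supported (R := k) (M := k)
      (disjoint_compl_right : Disjoint (S i) (S i)ᶜ))
    rw [Submodule.disjoint_def] at this
    exact B.repr.map_eq_zero_iff.1 (this _ ht ht')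
  · rw [eq_top_iff]
    rintro t -
    induction t using TensorProduct.induction_on with
    | zero => exact zero_mem _
    | add x y hx hy => exact add_mem hx hy
    | tmul f v =>
      have hv : v ∈ ⨆ i, V.grading i := V.isInternal.submodule_iSup_eq_top ▸ Submodule.mem_top
      induction hv using Submodule.iSup_induction' with
      | zero => rw [TensorProduct.tmul_zero]; exact zero_mem _
      | add x y _ _ hx hy => rw [TensorProduct.tmul_add]; exact add_mem hx hy
      | mem b v hv =>
        induction f using MvPolynomial.induction_on' with
        | add f g hf hg => rw [TensorProduct.add_tmul]; exact add_mem hf hg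
        | monomial m c =>
          exact Submodule.mem_iSup_of_mem _ (V.tmul_mem_extGrading
            (MvPolynomial.isWeightedHomogeneous_monomial _ m c rfl) hv rfl)

/-- The differential `d + ∑ xᵢ yᵢ` on `A ⊗ V`. -/
def extD : Module.End (MvPolynomial (Fin n) k) V.Ext :=
  V.d.baseChange _ + ∑ i, (MvPolynomial.X i : MvPolynomial (Fin n) k) • (V.y i).baseChange _

theorem extD_tmul (f : MvPolynomial (Fin n) k) (v : V.carrier) :
    V.extD (f ⊗ₜ v) = f ⊗ₜ V.d v + ∑ i, (MvPolynomial.X i * f) ⊗ₜ V.y i v := by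
  simp [extD, TensorProduct.smul_tmul']

theorem baseChange_commute {f g : Module.End k V.carrier} (h : Commute f g) :
    Commute (f.baseChange (MvPolynomial (Fin n) k) : Module.End _ V.Ext) (g.baseChange _) :=
  h.map (Module.End.baseChangeHom k (MvPolynomial (Fin n) k) V.carrier)

theorem baseChange_pow (f : Module.End k V.carrier) (l : ℕ) :
    (f.baseChange (MvPolynomial (Fin n) k) : Module.End _ V.Ext) ^ l = (f ^ l).baseChange _ :=
  (map_pow (Module.End.baseChangeHom k (MvPolynomial (Fin n) k) V.carrier) f l).symm

theorem natCast_end_eq_zero [CharP k p] (W : Type*) [AddCommGroup W]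
    [Module (MvPolynomial (Fin n) k) W] :
    (p : Module.End (MvPolynomial (Fin n) k) W) = 0 := by
  rw [← map_natCast (algebraMap (MvPolynomial (Fin n) k) _), CharP.cast_eq_zero, map_zero]

theorem add_pow_eq_zero {R : Type*} [Ring R] [hp : Fact p.Prime] (h0 : (p : R) = 0) {x y : R}
    (hc : Commute x y) (hx : x ^ p = 0) (hy : y ^ p = 0) : (x + y) ^ p = 0 := by
  obtain ⟨r, hr⟩ := hc.exists_add_pow_prime_eq hp.1
  rw [hr, hx, hy, h0]; simp

/-- All summands commute and are `p`-nilpotent, and the `p`-th power is additive on commuting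
elements in characteristic `p`. -/
theorem extD_pow [hp : Fact p.Prime] [CharP k p] : V.extD ^ p = 0 := by
  have h0 := natCast_end_eq_zero (p := p) (n := n) (k := k) V.Ext
  have hcomm : ∀ (f : Module.End k V.carrier) (s : Finset (Fin n)), (∀ i, Commute f (V.y i)) →
      Commute (f.baseChange (MvPolynomial (Fin n) k) : Module.End _ V.Ext)
        (∑ i ∈ s, (MvPolynomial.X i : MvPolynomial (Fin n) k) • (V.y i).baseChange _) := by
    intro f s hf
    exact Commute.sum_right _ _ _ fun i _ => (V.baseChange_commute (hf i)).smul_right _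
  refine add_pow_eq_zero h0 (hcomm _ _ V.d_comm) ?_ ?_
  · rw [baseChange_pow, V.d_pow, LinearMap.baseChange_zero]
  · generalize (Finset.univ : Finset (Fin n)) = s
    classical
    induction s using Finset.induction_on with
    | empty => rw [Finset.sum_empty, zero_pow hp.1.ne_zero]
    | insert i s hi ih =>
      rw [Finset.sum_insert hi]
      refine add_pow_eq_zero h0 ((hcomm _ _ (V.y_comm i)).smul_left _) ?_ ih
      rw [smul_pow, baseChange_pow, V.y_pow, LinearMap.baseChange_zero, smul_zero]

theorem X_mem_polyGrading (i : Fin n) :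
    (MvPolynomial.X i : MvPolynomial (Fin n) k) ∈ polyGrading n k (-1) :=
  MvPolynomial.isWeightedHomogeneous_X k (fun _ : Fin n => (-1 : ℤ)) i

/-- The map `A ⊗ V → V` that evaluates polynomials at the origin. -/
def extEval : V.Ext →ₗ[k] V.carrier :=
  TensorProduct.lift ((LinearMap.lsmul k V.carrier) ∘ₗ
    (MvPolynomial.aeval (0 : Fin n → k)).toLinearMap)

theorem extEval_tmul (f : MvPolynomial (Fin n) k) (v : V.carrier) :
    V.extEval (f ⊗ₜ v) = MvPolynomial.aeval (0 : Fin n → k) f • v := rfl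

theorem extEval_smul (f : MvPolynomial (Fin n) k) (t : V.Ext) :
    V.extEval (f • t) = MvPolynomial.aeval (0 : Fin n → k) f • V.extEval t := by
  induction t using TensorProduct.induction_on with
  | zero => simp
  | add x y hx hy => rw [smul_add, map_add, hx, hy, map_add, smul_add]
  | tmul g v =>
    rw [TensorProduct.smul_tmul', extEval_tmul, extEval_tmul, smul_eq_mul, map_mul, mul_smul]

theorem sub_C_mem_augIdeal (f : MvPolynomial (Fin n) k) :
    f - MvPolynomial.C (MvPolynomial.aeval (0 : Fin n → k) f) ∈ augIdeal n k := by
  induction f using MvPolynomial.induction_on with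
  | C a => simp
  | add f g hf hg =>
    rw [map_add, map_add, add_sub_add_comm]; exact add_mem hf hg
  | mul_X f i _ =>
    simp only [map_mul, MvPolynomial.aeval_X, Pi.zero_apply, mul_zero, map_zero, sub_zero]
    exact Ideal.mul_mem_left _ _ (Ideal.subset_span ⟨i, rfl⟩)

/-- The `p`-DG module `A ⊗ V` with differential `d + ∑ xᵢ yᵢ`. -/
def toPDGModule [hp : Fact p.Prime] [CharP k p] : PDGModule.{u, u} p n k where
  carrier := V.Ext
  grading := V.extGrading
  isInternal := V.extGrading_isInternal
  smul_mem := by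
    intro i j f m hf hm
    induction hm using Submodule.span_induction with
    | zero => rw [smul_zero]; exact zero_mem _
    | add x y _ _ hx hy => rw [smul_add]; exact add_mem hx hy
    | smul c x _ hx => rw [smul_comm]; exact Submodule.smul_mem _ _ hx
    | mem x hx =>
      obtain ⟨a, b, g, v, hg, hv, hab, rfl⟩ := hx
      rw [TensorProduct.smul_tmul', smul_eq_mul]
      exact V.tmul_mem_extGrading (MvPolynomial.IsWeightedHomogeneous.mul hf hg) hv (by omega)
  d := V.extD
  d_mem := by
    intro i m hm
    induction hm using Submodule.span_induction with
    | zero => rw [map_zero]; exact zero_mem _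
    | add x y _ _ hx hy => rw [map_add]; exact add_mem hx hy
    | smul c x _ hx =>
      rw [LinearMap.map_smul_of_tower]; exact Submodule.smul_mem _ _ hx
    | mem x hx =>
      obtain ⟨a, b, g, v, hg, hv, hab, rfl⟩ := hx
      rw [extD_tmul]
      refine add_mem (V.tmul_mem_extGrading hg (V.d_mem b v hv) (by omega))
        (Submodule.sum_mem _ fun j _ => ?_)
      exact V.tmul_mem_extGrading
        (MvPolynomial.IsWeightedHomogeneous.mul (X_mem_polyGrading j) hg)
        (V.y_mem j b v hv) (by omega)
  d_pow := V.extD_pow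

variable [hp : Fact p.Prime] [CharP k p]

theorem toPDGModule_isFree : V.toPDGModule.IsFree :=
  ⟨_, V.homBasis.baseChange (MvPolynomial (Fin n) k), fun j => j.1, fun j => by
    change V.homBasis.baseChange (MvPolynomial (Fin n) k) j ∈ V.extGrading j.1
    rw [Module.Basis.baseChange_apply]
    exact V.tmul_mem_extGrading (MvPolynomial.isWeightedHomogeneous_one k _) (V.homBasis_mem j)
      (zero_add _)⟩

theorem toPDGModule_isFG [Module.Finite k V.carrier] : V.toPDGModule.IsFG :=
  inferInstanceAs (Module.Finite (MvPolynomial (Fin n) k) V.Ext)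

/-- The map `A ⊗ V → (A ⊗ V) ⊗_A k`. -/
def extToFiber : V.Ext →ₗ[k] V.toPDGModule.Fiber := V.toPDGModule.toFiber

theorem extToFiber_eq_zero_iff (t : V.Ext) : V.extToFiber t = 0 ↔
    t ∈ augIdeal n k • (⊤ : Submodule (MvPolynomial (Fin n) k) V.Ext) :=
  V.toPDGModule.toFiber_eq_zero_iff t

/-- The map `V → (A ⊗ V) ⊗_A k`. -/
def toExtFiber : V.carrier →ₗ[k] V.toPDGModule.Fiber :=
  V.extToFiber ∘ₗ TensorProduct.mk k (MvPolynomial (Fin n) k) V.carrier 1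

/-- A polynomial differs from its value at the origin by an element of the augmentation ideal, which
dies in the fiber. -/
theorem extToFiber_tmul (f : MvPolynomial (Fin n) k) (v : V.carrier) :
    V.extToFiber (f ⊗ₜ v) = MvPolynomial.aeval (0 : Fin n → k) f • V.toExtFiber v := by
  set c := MvPolynomial.aeval (0 : Fin n → k) f
  have h : V.extToFiber ((f - MvPolynomial.C c) ⊗ₜ v) = 0 := by
    refine (V.extToFiber_eq_zero_iff _).2 ?_
    have : (f - MvPolynomial.C c) ⊗ₜ[k] v = (f - MvPolynomial.C c) • (1 ⊗ₜ v : V.Ext) := by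
      rw [TensorProduct.smul_tmul', smul_eq_mul, mul_one]
    rw [this]
    exact Submodule.smul_mem_smul (sub_C_mem_augIdeal f) trivial
  have h1 : MvPolynomial.C c ⊗ₜ[k] v = c • (1 ⊗ₜ v : V.Ext) := by
    rw [TensorProduct.smul_tmul', MvPolynomial.smul_eq_C_mul, mul_one]
  rw [TensorProduct.sub_tmul, map_sub, sub_eq_zero, h1, map_smul] at h
  exact h

/-- Evaluation at the origin kills `augIdeal n k • ⊤` and recovers `v` from `1 ⊗ v`. -/
theorem toExtFiber_injective : Function.Injective V.toExtFiber := by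
  rw [← LinearMap.ker_eq_bot, LinearMap.ker_eq_bot']
  intro v hv
  have h := (V.extToFiber_eq_zero_iff (1 ⊗ₜ v)).1 hv
  have key : ∀ t ∈ augIdeal n k • (⊤ : Submodule (MvPolynomial (Fin n) k) V.Ext),
      V.extEval t = 0 := by
    intro t ht
    induction ht using Submodule.smul_induction_on' with
    | add x _ y _ hx hy => rw [map_add, hx, hy, add_zero]
    | smul f hf t _ =>
      rw [extEval_smul]
      have : augIdeal n k ≤ RingHom.ker (MvPolynomial.aeval (0 : Fin n → k)) := by
        refine Ideal.span_le.2 ?_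
        rintro _ ⟨i, rfl⟩
        simp [RingHom.mem_ker]
      rw [(RingHom.mem_ker).1 (this hf), zero_smul]
  have h2 := key _ h
  rwa [extEval_tmul, map_one, one_smul] at h2

theorem toExtFiber_surjective : Function.Surjective V.toExtFiber := by
  intro t
  obtain ⟨t, rfl⟩ := V.toPDGModule.toFiber_surjective t
  change ∃ v, V.toExtFiber v = V.extToFiber t
  induction t using TensorProduct.induction_on with
  | zero => exact ⟨0, by rw [map_zero, map_zero]⟩
  | add x y hx hy =>
    obtain ⟨a, ha⟩ := hx
    obtain ⟨b, hb⟩ := hy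
    exact ⟨a + b, by rw [map_add, ha, hb, map_add]⟩
  | tmul f v => exact ⟨MvPolynomial.aeval (0 : Fin n → k) f • v, by rw [map_smul, extToFiber_tmul]⟩

/-- The fiber of `A ⊗ V` is `V`. -/
def fiberEquiv : V.carrier ≃ₗ[k] V.toPDGModule.fiber.carrier :=
  LinearEquiv.ofBijective V.toExtFiber ⟨V.toExtFiber_injective, V.toExtFiber_surjective⟩

theorem fiberEquiv_d (v : V.carrier) :
    V.fiberEquiv (V.d v) = V.toPDGModule.fiber.d (V.fiberEquiv v) := by
  change V.toExtFiber (V.d v) = V.extToFiber (V.extD (1 ⊗ₜ v))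
  rw [extD_tmul, map_add, map_sum, Finset.sum_eq_zero, add_zero]
  · rfl
  · intro i _
    rw [extToFiber_tmul]
    simp

theorem map_fiberEquiv_grading (i : ℤ) :
    (V.grading i).map V.fiberEquiv.toLinearMap = V.toPDGModule.fiber.grading i := by
  refine le_antisymm ?_ ?_
  · rintro _ ⟨v, hv, rfl⟩
    exact ⟨1 ⊗ₜ v, V.tmul_mem_extGrading (MvPolynomial.isWeightedHomogeneous_one k _) hv
      (zero_add _), rfl⟩
  · change (V.extGrading i).map V.extToFiber ≤ _
    refine Submodule.map_le_iff_le_comap.2 (Submodule.span_le.2 ?_)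
    rintro _ ⟨a, b, f, v, hf, hv, hab, rfl⟩
    change V.extToFiber (f ⊗ₜ v) ∈ (V.grading i).map V.toExtFiber
    rw [extToFiber_tmul]
    by_cases h : MvPolynomial.aeval (0 : Fin n → k) f = 0
    · rw [h, zero_smul]; exact zero_mem _
    -- A homogeneous polynomial with nonzero constant term has degree `0`, so `v` carries the whole
    -- degree.
    · have h0 : f.coeff 0 ≠ 0 := by
        rwa [MvPolynomial.aeval_zero, MvPolynomial.constantCoeff_eq] at h
      have ha : (0 : ℤ) = a := (map_zero (Finsupp.weight fun _ : Fin n => (-1 : ℤ))).symm.trans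
        (hf h0)
      have hb : b = i := by omega
      exact Submodule.smul_mem _ _ ⟨v, hb ▸ hv, rfl⟩

end NilpotentActionComplex

/-! ### Criteria for finite-dimensional homology -/

/-- A finitely generated module over a polynomial ring that is annihilated by a power of each
variable is finite-dimensional. -/
theorem MvPolynomial.finite_of_X_pow_smul_eq_zero {k : Type*} [Field k] {n : ℕ} {Q : Type*}
    [AddCommGroup Q] [Module k Q] [Module (MvPolynomial (Fin n) k) Q]
    [IsScalarTower k (MvPolynomial (Fin n) k) Q] [Module.Finite (MvPolynomial (Fin n) k) Q]
    (h : ∀ i : Fin n, ∃ N : ℕ, ∀ q : Q, (X i : MvPolynomial (Fin n) k) ^ N • q = 0) :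
    Module.Finite k Q := by
  set J := Module.annihilator (MvPolynomial (Fin n) k) Q with hJ
  let _ : Module (MvPolynomial (Fin n) k ⧸ J) Q := Module.quotientAnnihilator
  have : IsScalarTower (MvPolynomial (Fin n) k) (MvPolynomial (Fin n) k ⧸ J) Q :=
    ⟨fun a b q => by
      obtain ⟨b, rfl⟩ := Ideal.Quotient.mk_surjective b
      exact mul_smul a b q⟩
  have : IsScalarTower k (MvPolynomial (Fin n) k ⧸ J) Q :=
    ⟨fun a b q => by
      obtain ⟨b, rfl⟩ := Ideal.Quotient.mk_surjective b
      exact smul_assoc a b q⟩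
  -- The variables are nilpotent modulo the annihilator `J`, so `A / J` is integral over `k`; being
  -- a finitely generated algebra, it is finite-dimensional.
  have hint : ∀ f : MvPolynomial (Fin n) k, IsIntegral k (Ideal.Quotient.mk J f) := by
    intro f
    induction f using MvPolynomial.induction_on with
    | C a => exact isIntegral_algebraMap (R := k) (A := MvPolynomial (Fin n) k ⧸ J) (x := a)
    | add f g hf hg => rw [map_add]; exact hf.add hg
    | mul_X f i hf =>
      rw [map_mul]
      refine hf.mul ?_
      obtain ⟨N, hN⟩ := h i
      refine IsIntegral.of_pow (n := N + 1) (Nat.succ_pos _) ?_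
      rw [← map_pow, Ideal.Quotient.eq_zero_iff_mem.2]
      · exact isIntegral_zero
      · rw [hJ, Module.mem_annihilator]
        intro q
        rw [pow_succ', mul_smul, hN, smul_zero]
  have : Algebra.IsIntegral k (MvPolynomial (Fin n) k ⧸ J) :=
    ⟨fun x => by
      obtain ⟨f, rfl⟩ := Ideal.Quotient.mk_surjective x
      exact hint f⟩
  have : Module.Finite k (MvPolynomial (Fin n) k ⧸ J) := Algebra.IsIntegral.finite
  have : Module.Finite (MvPolynomial (Fin n) k ⧸ J) Q :=
    Module.Finite.of_restrictScalars_finite (MvPolynomial (Fin n) k) _ _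
  exact Module.Finite.trans (MvPolynomial (Fin n) k ⧸ J) Q

namespace NComplex

variable {N : ℕ} {k : Type u} [Field k]

theorem d_pow_mem (C : NComplex.{u, v} N k) (l : ℕ) {i : ℤ} {x : C.carrier}
    (hx : x ∈ C.grading i) : (C.d ^ l) x ∈ C.grading (i - l) := by
  induction l with
  | zero => simpa using hx
  | succ l ih =>
    rw [pow_succ', Module.End.mul_apply]
    have := C.d_mem _ _ ih
    rwa [show i - (l : ℤ) - 1 = i - ((l + 1 : ℕ) : ℤ) by push_cast; ring] at this

theorem totalHomology_nontrivial (C : NComplex.{u, v} N k) {s : ℕ} {i : ℤ}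
    (h : ¬ C.cycles s i ≤ C.boundaries s i) : Nontrivial (C.totalHomology s) := by
  obtain ⟨z, hz, hz'⟩ := SetLike.not_le_iff_exists.1 h
  classical
  have h : ((C.boundaries s i).submoduleOf (C.cycles s i)).mkQ ⟨z, hz⟩ ≠ 0 := by
    intro h
    rw [Submodule.mkQ_apply, Submodule.Quotient.mk_eq_zero] at h
    exact hz' h
  refine ⟨DirectSum.lof k ℤ (C.homology s) i (Submodule.mkQ _ ⟨z, hz⟩), 0, fun h0 => h ?_⟩
  have := congrArg (DirectSum.component k ℤ (C.homology s) i) h0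
  rwa [DirectSum.component.lof_self, map_zero] at this

/-- The chains of degree `i` modulo the boundaries. -/
abbrev chainQuotient (C : NComplex.{u, v} N k) (s : ℕ) (i : ℤ) : Type v :=
  C.grading i ⧸ (C.boundaries s i).submoduleOf (C.grading i)

/-- The total homology is finite-dimensional if all cycles lie, up to boundaries, in a
finite-dimensional subspace, which need not be graded. -/
theorem totalHomology_finite (C : NComplex.{u, v} N k) (s : ℕ) (hs : s ≤ N)
    (W : Submodule k C.carrier) [Module.Finite k W]
    (hW : LinearMap.ker (C.d ^ s) ≤ W ⊔ LinearMap.range (C.d ^ (N - s))) :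
    Module.Finite k (C.totalHomology s) := by
  classical
  let e := LinearEquiv.ofBijective (DirectSum.coeLinearMap C.grading) C.isInternal
  -- `T` splits a chain into homogeneous parts modulo boundaries. It kills the image of `d ^ (N -
  -- s)`, so it maps all cycles into the finite-dimensional space `T(W)`; the total homology embeds
  -- in the target of `T` with image inside `T(W)`.
  let T : C.carrier →ₗ[k] ⨁ i, C.chainQuotient s i :=
    DirectSum.lmap (fun i => Submodule.mkQ _) ∘ₗ e.symm.toLinearMap
  have hT : ∀ i (x : C.grading i), T x = DirectSum.lof k ℤ (C.chainQuotient s) i (Submodule.mkQ _ x) := by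
    intro i x
    have h1 : e.symm (x : C.carrier) = DirectSum.lof k ℤ (fun i => C.grading i) i x := by
      rw [LinearEquiv.symm_apply_eq]
      exact (DirectSum.coeLinearMap_lof C.grading i x).symm
    change DirectSum.lmap _ (e.symm (x : C.carrier)) = _
    rw [h1, DirectSum.lmap_lof]
  have hB : LinearMap.range (C.d ^ (N - s)) ≤ LinearMap.ker T := by
    rintro _ ⟨x, rfl⟩
    have hx : x ∈ ⨆ i, C.grading i := C.isInternal.submodule_iSup_eq_top ▸ Submodule.mem_top
    induction hx using Submodule.iSup_induction' with
    | zero => rw [map_zero]; exact zero_mem _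
    | add x y _ _ hx hy => rw [map_add]; exact add_mem hx hy
    | mem j x hx =>
      have h1 : (C.d ^ (N - s)) x ∈ C.grading (j - ((N - s : ℕ) : ℤ)) := C.d_pow_mem _ hx
      rw [LinearMap.mem_ker, hT _ ⟨_, h1⟩]
      have h2 : (C.d ^ (N - s)) x ∈ C.boundaries s (j - ((N - s : ℕ) : ℤ)) :=
        ⟨x, by
          rwa [show j - ((N - s : ℕ) : ℤ) + N - s = j by rw [Nat.cast_sub hs]; ring], rfl⟩
      have h3 : Submodule.mkQ ((C.boundaries s (j - ((N - s : ℕ) : ℤ))).submoduleOf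
          (C.grading (j - ((N - s : ℕ) : ℤ)))) ⟨_, h1⟩ = 0 := by
        rw [Submodule.mkQ_apply, Submodule.Quotient.mk_eq_zero]
        exact h2
      rw [h3, map_zero]
  let ι : ∀ i, C.homology s i →ₗ[k] C.chainQuotient s i := fun i =>
    Submodule.mapQ _ _ (Submodule.inclusion (inf_le_left : C.cycles s i ≤ C.grading i))
      (fun x hx => hx)
  have hι : ∀ i, Function.Injective (ι i) := by
    intro i
    rw [← LinearMap.ker_eq_bot, LinearMap.ker_eq_bot']
    intro x hx
    obtain ⟨x, rfl⟩ := Submodule.mkQ_surjective _ x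
    have hx : (Submodule.Quotient.mk (Submodule.inclusion inf_le_left x) :
        C.chainQuotient s i) = 0 := hx
    rw [Submodule.Quotient.mk_eq_zero] at hx
    rw [Submodule.mkQ_apply, Submodule.Quotient.mk_eq_zero]
    exact hx
  have hle : LinearMap.range (DirectSum.lmap ι) ≤ W.map T := by
    rintro _ ⟨x, rfl⟩
    induction x using DirectSum.induction_on with
    | zero => rw [map_zero]; exact zero_mem _
    | add x y hx hy => rw [map_add]; exact add_mem hx hy
    | of i x =>
      obtain ⟨x, rfl⟩ := Submodule.mkQ_surjective _ x
      have h1 : T (x : C.carrier) = DirectSum.lmap ι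
          (DirectSum.lof k ℤ (C.homology s) i (Submodule.mkQ _ x)) := by
        rw [DirectSum.lmap_lof, hT i ⟨x, x.2.1⟩]
        rfl
      obtain ⟨w, hw, c, hc, hwc⟩ := Submodule.mem_sup.1 (hW x.2.2)
      refine ⟨w, hw, Eq.trans ?_ h1⟩
      rw [← hwc, map_add, LinearMap.mem_ker.1 (hB hc), add_zero]
  have hfin : Module.Finite k (LinearMap.range (DirectSum.lmap ι)) :=
    Module.Finite.of_injective (Submodule.inclusion hle) (Submodule.inclusion_injective hle)
  have hinj : Function.Injective (DirectSum.lmap ι) := DirectSum.lmap_injective ι |>.2 hι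
  exact Module.Finite.equiv (LinearEquiv.ofInjective _ hinj).symm

section Equiv

variable {C C' : NComplex.{u, u} N k} (e : C.carrier ≃ₗ[k] C'.carrier)
  (hd : ∀ x, e (C.d x) = C'.d (e x))
  (hg : ∀ i, (C.grading i).map e.toLinearMap = C'.grading i)

include hd in
theorem equiv_d_pow (l : ℕ) (x : C.carrier) : e ((C.d ^ l) x) = (C'.d ^ l) (e x) := by
  induction l with
  | zero => rfl
  | succ l ih => rw [pow_succ', pow_succ', Module.End.mul_apply, Module.End.mul_apply, hd, ih]

include hd hg in
theorem map_cycles (s : ℕ) (i : ℤ) : (C.cycles s i).map e.toLinearMap = C'.cycles s i := by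
  refine le_antisymm ?_ ?_
  · rintro _ ⟨x, ⟨hx, hx'⟩, rfl⟩
    refine ⟨hg i ▸ ⟨x, hx, rfl⟩, ?_⟩
    rw [SetLike.mem_coe, LinearMap.mem_ker] at hx' ⊢
    exact (equiv_d_pow e hd s x).symm.trans (by rw [hx', map_zero])
  · rintro z ⟨hz, hz'⟩
    rw [← hg i] at hz
    obtain ⟨x, hx, rfl⟩ := hz
    refine ⟨x, ⟨hx, ?_⟩, rfl⟩
    rw [SetLike.mem_coe, LinearMap.mem_ker] at hz' ⊢
    exact e.map_eq_zero_iff.1 ((equiv_d_pow e hd s x).trans hz')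

include hd hg in
theorem map_boundaries (s : ℕ) (i : ℤ) :
    (C.boundaries s i).map e.toLinearMap = C'.boundaries s i := by
  rw [boundaries, boundaries, ← hg, ← Submodule.map_comp, ← Submodule.map_comp]
  congr 1
  exact LinearMap.ext (equiv_d_pow e hd (N - s))

include hd hg in
theorem homologyDim_eq (s : ℕ) : C.homologyDim s = C'.homologyDim s := by
  refine tsum_congr fun i => ?_
  have hc := map_cycles e hd hg s i
  have hb := map_boundaries e hd hg s i
  have e' : C.homology s i ≃ₗ[k] C'.homology s i := by
    refine Submodule.Quotient.equiv _ _ (e.ofSubmodules _ _ hc) ?_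
    ext z
    constructor
    · rintro ⟨x, hx, rfl⟩
      exact hb ▸ ⟨x, hx, rfl⟩
    · intro hz
      have hz : (z : C'.carrier) ∈ C'.boundaries s i := hz
      rw [← hb] at hz
      obtain ⟨x, hx, hxz⟩ := hz
      have hxc : x ∈ C.cycles s i := by
        obtain ⟨x', hx', hxz'⟩ := (SetLike.ext_iff.1 hc _).2 z.2
        rwa [← e.injective (hxz'.trans hxz.symm)]
      exact ⟨⟨x, hxc⟩, hx, Subtype.ext hxz⟩
  rw [eDim, eDim, e'.rank_eq]

end Equiv

end NComplex

namespace PDGModule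

/-- If a power of each variable annihilates the homology, then the homology is finite-dimensional. -/
theorem totalHomology_finite {p n : ℕ} {k : Type u} [Field k] (M : PDGModule.{u, v} p n k)
    (hfg : M.IsFG) (s : ℕ) (hs : s ≤ p)
    (h : ∀ i : Fin n, ∃ N : ℕ, ∀ z : M.carrier, (M.d ^ s) z = 0 →
      (MvPolynomial.X i : MvPolynomial (Fin n) k) ^ N • z ∈ LinearMap.range (M.d ^ (p - s))) :
    Module.Finite k (M.toNComplex.totalHomology s) := by
  -- As `A` is noetherian, the cycles are finitely generated.
  have : Module.Finite (MvPolynomial (Fin n) k) M.carrier := hfg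
  let K : Submodule (MvPolynomial (Fin n) k) M.carrier := LinearMap.ker (M.d ^ s)
  let B : Submodule (MvPolynomial (Fin n) k) M.carrier := LinearMap.range (M.d ^ (p - s))
  have : Module.Finite k (K ⧸ B.submoduleOf K) := by
    refine MvPolynomial.finite_of_X_pow_smul_eq_zero (n := n) fun i => ?_
    obtain ⟨N, hN⟩ := h i
    refine ⟨N, fun q => ?_⟩
    obtain ⟨z, rfl⟩ := Submodule.mkQ_surjective _ q
    rw [← map_smul, Submodule.mkQ_apply, Submodule.Quotient.mk_eq_zero]
    exact hN z z.2
  have hpow : ∀ l : ℕ, ∀ z : M.carrier, (M.toNComplex.d ^ l) z = (M.d ^ l) z := by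
    intro l
    induction l with
    | zero => intro z; rfl
    | succ l ih =>
      intro z
      rw [pow_succ, pow_succ, Module.End.mul_apply]
      exact ih _
  -- A `k`-linear section chooses representatives of the ungraded homology; their span serves as
  -- `W`.
  obtain ⟨g, hg⟩ := LinearMap.exists_rightInverse_of_surjective
    ((B.submoduleOf K).mkQ.restrictScalars k)
    (LinearMap.range_eq_top.2 (Submodule.mkQ_surjective (B.submoduleOf K)))
  let W : Submodule k M.toNComplex.carrier :=
    (LinearMap.range g).map (K.subtype.restrictScalars k)
  have : Module.Finite k W := inferInstanceAs
    (Module.Finite k ((LinearMap.range g).map (K.subtype.restrictScalars k)))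
  refine NComplex.totalHomology_finite _ s hs W fun z hz => ?_
  let z' : K := ⟨z, (hpow s z).symm.trans hz⟩
  have h1 : (B.submoduleOf K).mkQ (z' - g ((B.submoduleOf K).mkQ z')) = 0 := by
    rw [map_sub, sub_eq_zero]
    exact (LinearMap.congr_fun hg _).symm
  rw [Submodule.mkQ_apply, Submodule.Quotient.mk_eq_zero] at h1
  obtain ⟨c, hc⟩ := h1
  refine Submodule.mem_sup.2 ⟨K.subtype (g ((B.submoduleOf K).mkQ z')), ⟨_, ⟨_, rfl⟩, rfl⟩,
    (M.toNComplex.d ^ (p - s)) c, ⟨c, rfl⟩, ?_⟩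
  have h2 : (M.d ^ (p - s)) c = (z' : M.carrier) - K.subtype (g ((B.submoduleOf K).mkQ z')) := hc
  exact (congrArg _ ((hpow _ c).trans h2)).trans (add_sub_cancel _ z)

end PDGModule

/-! ### Finiteness of the homology of `A ⊗ V` -/

namespace NilpotentActionComplex

variable {p n : ℕ} {k : Type u} [Field k] (V : NilpotentActionComplex p n k)

theorem baseChange_apply_mem {F F' : Submodule k V.carrier} {f : Module.End k V.carrier}
    (h : ∀ v ∈ F, f v ∈ F') (z : V.Ext) (hz : z ∈ F.baseChange (MvPolynomial (Fin n) k)) :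
    f.baseChange (MvPolynomial (Fin n) k) z ∈ F'.baseChange (MvPolynomial (Fin n) k) := by
  obtain ⟨t, rfl⟩ := hz
  induction t using TensorProduct.induction_on with
  | zero => rw [map_zero, map_zero]; exact zero_mem _
  | add x y hx hy => rw [map_add, map_add]; exact add_mem hx hy
  | tmul a v =>
    rw [LinearMap.baseChange_tmul, LinearMap.baseChange_tmul]
    exact Submodule.tmul_mem_baseChange_of_mem a (h _ v.2)

theorem baseChange_contraction (y h : Module.End k V.carrier) :
    contraction p (y.baseChange (MvPolynomial (Fin n) k) : Module.End _ V.Ext) (h.baseChange _) =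
      (contraction p y h).baseChange _ := by
  have := map_sum (Module.End.baseChangeHom k (MvPolynomial (Fin n) k) V.carrier)
    (fun i => y ^ i * h * y ^ (p - 1 - i)) (Finset.range p)
  simp only [map_mul, map_pow] at this
  exact this.symm

variable [hp : Fact p.Prime] [CharP k p]

/-- With `V` filtered by degree, `d` lowers the filtration while the `yⱼ` and `h` preserve it; `e`
collects the terms `xⱼ yⱼ` with `j ≠ i`. -/
theorem exists_X_pow_smul_mem_range (i : Fin n) {a b : ℤ}
    (hab : ∀ j, j < a ∨ b < j → V.grading j = ⊥) {h : Module.End k V.carrier}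
    (hh : ∀ j, ∀ v ∈ V.grading j, h v ∈ V.grading j) (hc : contraction p (V.y i) h = 1)
    (hcomm : ∀ j, j ≠ i → Commute (V.y j) h) :
    ∃ N : ℕ, ∀ s ≤ p, ∀ z : V.Ext, (V.extD ^ s) z = 0 →
      (MvPolynomial.X i : MvPolynomial (Fin n) k) ^ N • z ∈
        LinearMap.range (V.extD ^ (p - s)) := by
  classical
  let A := MvPolynomial (Fin n) k
  -- The strict inequality makes `F 0` vanish, and the filtration is exhausted at index `b + 1 - a`.
  let F : ℕ → Submodule k V.carrier := fun l => ⨆ j : {j : ℤ // j < a + l}, V.grading j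
  have hF : ∀ (f : Module.End k V.carrier), (∀ j, ∀ v ∈ V.grading j, f v ∈ V.grading j) →
      ∀ l, ∀ v ∈ F l, f v ∈ F l := by
    intro f hf l v hv
    induction hv using Submodule.iSup_induction' with
    | zero => rw [map_zero]; exact zero_mem _
    | add x y _ _ hx hy => rw [map_add]; exact add_mem hx hy
    | mem j x hx => exact Submodule.mem_iSup_of_mem j (hf _ _ hx)
  let e : Module.End A V.Ext := ∑ j ∈ Finset.univ.erase i,
    (MvPolynomial.X j : MvPolynomial (Fin n) k) • (V.y j).baseChange A
  have hD : V.extD = V.d.baseChange A +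
      ((MvPolynomial.X i : MvPolynomial (Fin n) k) • (V.y i).baseChange A + e) := by
    rw [extD, ← Finset.add_sum_erase _ _ (Finset.mem_univ i)]
  have hpow := V.extD_pow
  rw [hD] at hpow ⊢
  have h0 : (p : A) = 0 := CharP.cast_eq_zero A p
  refine exists_pow_smul_mem_range h0 (fun l => (F l).baseChange A) (b + 1 - a).toNat
    ?_ ?_ ?_ _ (h := h.baseChange A) ?_ ?_ ?_ ?_ ?_ ?_ ?_ hpow
  · have : F 0 = ⊥ := by
      refine iSup_eq_bot.2 fun j => hab _ (Or.inl ?_)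
      have := j.2
      simpa using this
    change (F 0).baseChange A = ⊥
    rw [this, Submodule.baseChange_bot]
  · have : F (b + 1 - a).toNat = ⊤ := by
      rw [eq_top_iff, ← V.isInternal.submodule_iSup_eq_top]
      refine iSup_le fun j => ?_
      by_cases hj : j < a + (b + 1 - a).toNat
      · exact le_iSup (fun j : {j : ℤ // j < a + (b + 1 - a).toNat} => V.grading j) ⟨j, hj⟩
      · rw [hab j (Or.inr (by omega))]; exact bot_le
    change (F (b + 1 - a).toNat).baseChange A = ⊤
    rw [this, Submodule.baseChange_top]
  · intro l
    refine Submodule.baseChange_mono A ?_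
    refine iSup_le fun j => ?_
    have := j.2
    exact le_iSup (fun j : {j : ℤ // j < a + (l + 1 : ℕ)} => V.grading j)
      ⟨j, by push_cast; omega⟩
  · intro l
    refine V.baseChange_apply_mem ?_
    intro v hv
    induction hv using Submodule.iSup_induction' with
    | zero => rw [map_zero]; exact zero_mem _
    | add x y _ _ hx hy => rw [map_add]; exact add_mem hx hy
    | mem j x hx =>
      have := j.2
      exact Submodule.mem_iSup_of_mem (⟨j - 1, by push_cast at this; omega⟩ :
        {j : ℤ // j < a + l}) (V.d_mem _ _ hx)
  · exact fun l => V.baseChange_apply_mem (hF _ (V.y_mem i) l)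
  · intro l z hz
    rw [LinearMap.sum_apply]
    exact Submodule.sum_mem _ fun j _ => Submodule.smul_mem _ _
      (V.baseChange_apply_mem (hF _ (V.y_mem j) l) z hz)
  · exact fun l => V.baseChange_apply_mem (hF _ hh l)
  · exact Commute.sum_left _ _ _ fun j _ =>
      (V.baseChange_commute (V.y_comm j i)).smul_left _
  · exact Commute.sum_left _ _ _ fun j hj =>
      (V.baseChange_commute (hcomm j (Finset.ne_of_mem_erase hj))).smul_left _
  · rw [baseChange_contraction, hc]
    exact map_one (Module.End.baseChangeHom k (MvPolynomial (Fin n) k) V.carrier)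

theorem totalHomology_toPDGModule_finite [Module.Finite k V.carrier] {a b : ℤ}
    (hab : ∀ j, j < a ∨ b < j → V.grading j = ⊥)
    (hh : ∀ i, ∃ h : Module.End k V.carrier, (∀ j, ∀ v ∈ V.grading j, h v ∈ V.grading j) ∧
      contraction p (V.y i) h = 1 ∧ ∀ j, j ≠ i → Commute (V.y j) h) (s : ℕ) (hs : s ≤ p) :
    Module.Finite k (V.toPDGModule.toNComplex.totalHomology s) := by
  refine V.toPDGModule.totalHomology_finite V.toPDGModule_isFG s hs fun i => ?_
  obtain ⟨h, h1, h2, h3⟩ := hh i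
  obtain ⟨N, hN⟩ := V.exists_X_pow_smul_mem_range i hab h1 h2 h3
  exact ⟨N, hN s hs⟩

end NilpotentActionComplex

theorem ENat.summable {ι : Type*} {f : ι → ℕ∞} : Summable f :=
  (hasSum_of_isLUB _ isLUB_iSup).summable

/-! ### The degree function of the stretching -/

section Stretch

/-- The function `m ↦ ⌊m / p⌋ + ⌈m / p⌉`. -/
def stretch (p : ℕ) (m : ℤ) : ℤ := m / p - (-m) / p

variable {p : ℕ}

theorem stretch_mono (p : ℕ) : Monotone (stretch p) := by
  intro a b h
  rcases p.eq_zero_or_pos with rfl | hp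
  · simp [stretch]
  · have hp : (0 : ℤ) < p := by exact_mod_cast hp
    exact sub_le_sub (Int.ediv_le_ediv hp h) (Int.ediv_le_ediv hp (neg_le_neg h))

theorem stretch_mul_add (hp : 0 < p) (q r : ℤ) : stretch p (p * q + r) = 2 * q + stretch p r := by
  have h : (p : ℤ) ≠ 0 := by exact_mod_cast hp.ne'
  rw [stretch, stretch, show -((p : ℤ) * q + r) = p * (-q) + -r by ring,
    Int.mul_add_ediv_left _ _ h, Int.mul_add_ediv_left _ _ h]
  ring

theorem stretch_of_pos {r : ℤ} (h0 : 0 < r) (hr : r < p) : stretch p r = 1 := by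
  have h1 : (-r) / (p : ℤ) = -1 := by
    rw [Int.ediv_eq_iff_of_pos (by omega)]
    constructor <;> linarith
  rw [stretch, Int.ediv_eq_zero_of_lt h0.le hr, h1]
  rfl

theorem stretch_zero : stretch p 0 = 0 := by simp [stretch]

theorem stretch_mul (hp : 0 < p) (q : ℤ) : stretch p (p * q) = 2 * q := by
  rw [← add_zero ((p : ℤ) * q), stretch_mul_add hp, stretch_zero, add_zero]

theorem stretch_add_self (hp : 0 < p) (m : ℤ) : stretch p (m + p) = stretch p m + 2 := by
  rw [show m + (p : ℤ) = p * 1 + m by ring, stretch_mul_add hp]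
  ring

/-- The value `2q` is taken only at `pq`, and `2q + 1` on the `p - 1` integers between `pq` and `p(q
+ 1)`. Hence `m = pq` serves for `i = 2q`, and `m = pq + s` for `i = 2q + 1`. -/
theorem exists_stretch_eq {s : ℤ} (hs : 0 < s) (hsp : s < p) (i : ℤ) :
    ∃ m, stretch p m = i ∧ stretch p (m - s) = i - 1 := by
  have hp : 0 < p := by omega
  rcases Int.even_or_odd' i with ⟨q, rfl | rfl⟩
  · refine ⟨p * q, stretch_mul hp q, ?_⟩
    rw [show (p : ℤ) * q - s = p * (q - 1) + (p - s) by ring, stretch_mul_add hp,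
      stretch_of_pos (by omega) (by omega)]
    ring
  · refine ⟨p * q + s, ?_, ?_⟩
    · rw [stretch_mul_add hp, stretch_of_pos hs hsp]
    · rw [add_sub_cancel_right, stretch_mul hp, add_sub_cancel_right]

/-- A point just below which the function drops is the least one with its value. -/
theorem eq_of_stretch_eq {m m' : ℤ} (h : stretch p (m - 1) = stretch p m - 1)
    (h' : stretch p (m' - 1) = stretch p m' - 1) (heq : stretch p m = stretch p m') : m = m' := by
  rcases lt_trichotomy m m' with hlt | rfl | hlt
  · have := stretch_mono p (show m ≤ m' - 1 by omega); omega
  · rfl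
  · have := stretch_mono p (show m' ≤ m - 1 by omega); omega

theorem stretch_sub_one (hp : 2 ≤ p) (m : ℤ) :
    stretch p (m - 1) = stretch p m ∨ stretch p (m - 1) = stretch p m - 1 := by
  have h1 := stretch_mono p (show m - 1 ≤ m by omega)
  obtain ⟨m', h2, -⟩ := exists_stretch_eq (p := p) one_pos (by omega) (stretch p m - 1)
  by_contra! h
  rcases le_or_gt m m' with h3 | h3
  · have := stretch_mono p h3; omega
  · have := stretch_mono p (show m' ≤ m - 1 by omega); omega

end Stretch

/-! ### Stretching a chain complex to a `p`-complex -/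

/-- A chain complex of modules over a `k`-algebra `R`, with explicit differentials between any two
degrees, which vanish unless the degree drops by one. -/
structure ModuleComplex (k R : Type u) [Field k] [Ring R] [Algebra k R] where
  X : ℤ → Type u
  [addCommGroup : ∀ i, AddCommGroup (X i)]
  [moduleBase : ∀ i, Module k (X i)]
  [module : ∀ i, Module R (X i)]
  [isScalarTower : ∀ i, IsScalarTower k R (X i)]
  d : ∀ i j, X i →ₗ[R] X j
  shape : ∀ i j, j + 1 ≠ i → d i j = 0
  d_comp : ∀ i j l x, d j l (d i j x) = 0

namespace ModuleComplex

attribute [instance] ModuleComplex.addCommGroup ModuleComplex.moduleBase ModuleComplex.module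
  ModuleComplex.isScalarTower

section

variable {k R : Type u} [Field k] [Ring R] [Algebra k R] (C : ModuleComplex k R)

/-- The identity if `a = b`, and the differential otherwise. -/
def trans (a b : ℤ) : C.X a →ₗ[R] C.X b :=
  if h : a = b then h ▸ LinearMap.id else C.d a b

theorem trans_self (a : ℤ) (x : C.X a) : C.trans a a x = x := by
  rw [trans, dif_pos rfl]; rfl

theorem trans_of_ne {a b : ℤ} (h : a ≠ b) : C.trans a b = C.d a b := dif_neg h

/-- Two proper differentials compose to zero, and so does the direct map, because the degree then
drops by at least two. Thus a power of the stretched differential is a single `trans`. -/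
theorem trans_trans {a b c : ℤ} (hab : b ≤ a) (hbc : c ≤ b) (x : C.X a) :
    C.trans b c (C.trans a b x) = C.trans a c x := by
  by_cases h1 : a = b
  · subst h1; rw [trans_self]
  by_cases h2 : b = c
  · subst h2; rw [trans_self]
  rw [C.trans_of_ne h1, C.trans_of_ne h2, C.trans_of_ne (by omega), C.d_comp,
    C.shape a c (by omega), LinearMap.zero_apply]

theorem trans_eq_zero {a b : ℤ} (h : b + 1 < a) : C.trans a b = 0 := by
  rw [C.trans_of_ne (by omega), C.shape _ _ (by omega)]

/-- The kernel of the differential, as a vector space. -/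
def cycles (i : ℤ) : Submodule k (C.X i) := (LinearMap.ker (C.d i (i - 1))).restrictScalars k

/-- The image of the differential, as a vector space. -/
def boundaries (i : ℤ) : Submodule k (C.X i) :=
  (LinearMap.range (C.d (i + 1) i)).restrictScalars k

theorem trans_eq_d {a b i : ℤ} (ha : a = i) (hb : b = i - 1) (x : C.X a) :
    C.trans a b x = 0 ↔ ha ▸ x ∈ C.cycles i := by
  subst ha hb
  rw [C.trans_of_ne (by omega)]
  rfl

theorem exists_trans_eq {a i : ℤ} (ha : a = i + 1) (x : C.X i) :
    (∃ y, C.trans a i y = x) ↔ x ∈ C.boundaries i := by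
  subst ha
  rw [C.trans_of_ne (by omega)]
  rfl

/-- The homology, as a vector space. -/
abbrev homology (i : ℤ) : Type u := C.cycles i ⧸ (C.boundaries i).submoduleOf (C.cycles i)

/-- The underlying space of the `p`-complex obtained by repeating the modules of odd degree
`p - 1` times. -/
abbrev Stretched (p : ℕ) : Type u := ⨁ m : ℤ, C.X (stretch p m)

/-- The inclusion of the `m`-th summand. -/
abbrev incl (p : ℕ) (m : ℤ) : C.X (stretch p m) →ₗ[k] C.Stretched p :=
  DirectSum.lof k ℤ (fun m => C.X (stretch p m)) m

/-- The projection to the `m`-th summand. -/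
abbrev comp (p : ℕ) (m : ℤ) : C.Stretched p →ₗ[k] C.X (stretch p m) :=
  DirectSum.component k ℤ (fun m => C.X (stretch p m)) m

theorem incl_injective (p : ℕ) (m : ℤ) : Function.Injective (C.incl p m) :=
  Function.LeftInverse.injective (g := C.comp p m) fun x => by
    rw [DirectSum.component.lof_self]

theorem incl_ext {p : ℕ} {W : Type*} [AddCommGroup W] [Module k W] {f g : C.Stretched p →ₗ[k] W}
    (h : ∀ m x, f (C.incl p m x) = g (C.incl p m x)) : f = g :=
  DirectSum.linearMap_ext k fun m => LinearMap.ext (h m)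

/-- The differential of the stretched complex. -/
def stretchD (p : ℕ) : Module.End k (C.Stretched p) :=
  DirectSum.toModule k ℤ _ fun m =>
    C.incl p (m - 1) ∘ₗ (C.trans (stretch p m) (stretch p (m - 1))).restrictScalars k

theorem stretchD_incl (p : ℕ) (m : ℤ) (x : C.X (stretch p m)) : C.stretchD p (C.incl p m x) =
    C.incl p (m - 1) (C.trans (stretch p m) (stretch p (m - 1)) x) := by
  rw [stretchD, DirectSum.toModule_lof]; rfl

theorem stretchD_pow_incl (p l : ℕ) {m m' : ℤ} (h : m' = m - l) (x : C.X (stretch p m)) :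
    (C.stretchD p ^ l) (C.incl p m x) =
      C.incl p m' (C.trans (stretch p m) (stretch p m') x) := by
  induction l generalizing m' with
  | zero =>
    obtain rfl : m' = m := by simpa using h
    rw [trans_self]; rfl
  | succ l ih =>
    obtain rfl : m' = (m - l) - 1 := by rw [h]; push_cast; ring
    rw [pow_succ', Module.End.mul_apply, ih rfl, stretchD_incl,
      C.trans_trans (stretch_mono p (by omega)) (stretch_mono p (by omega))]

theorem range_incl_isInternal (p : ℕ) :
    DirectSum.IsInternal fun m => LinearMap.range (C.incl p m) := by
  classical
  apply DirectSum.isInternal_submodule_of_iSupIndep_of_iSup_eq_top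
  · intro i
    rw [Submodule.disjoint_def]
    rintro _ ⟨x, rfl⟩ h
    have hle : (⨆ j, ⨆ (_ : j ≠ i), LinearMap.range (C.incl p j)) ≤
        LinearMap.ker (C.comp p i) := by
      refine iSup₂_le fun j hj => ?_
      rintro _ ⟨y, rfl⟩
      rw [LinearMap.mem_ker, DirectSum.component.of, dif_neg hj]
    have h1 := LinearMap.mem_ker.1 (hle h)
    rw [DirectSum.component.lof_self] at h1
    rw [h1, map_zero]
  · rw [eq_top_iff]
    rintro x -
    induction x using DirectSum.induction_on with
    | zero => exact zero_mem _
    | add x y hx hy => exact add_mem hx hy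
    | of m x => exact Submodule.mem_iSup_of_mem m ⟨x, rfl⟩

theorem lmap_pow_incl (p : ℕ) (f : ∀ m, Module.End k (C.X (stretch p m))) (l : ℕ) (m : ℤ)
    (x : C.X (stretch p m)) :
    ((DirectSum.lmap f : Module.End k (C.Stretched p)) ^ l) (C.incl p m x) =
      C.incl p m ((f m ^ l) x) := by
  induction l generalizing x with
  | zero => rfl
  | succ l ih =>
    rw [pow_succ, pow_succ, Module.End.mul_apply, Module.End.mul_apply, DirectSum.lmap_lof, ih]

theorem contraction_lmap (p : ℕ) {f h : ∀ m, Module.End k (C.X (stretch p m))}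
    (hc : ∀ m, contraction p (f m) (h m) = 1) :
    contraction p (DirectSum.lmap f : Module.End k (C.Stretched p)) (DirectSum.lmap h) = 1 := by
  refine C.incl_ext fun m x => ?_
  have h1 := congrArg (C.incl p m) (LinearMap.congr_fun (hc m) x)
  rw [contraction, LinearMap.sum_apply, map_sum] at h1
  rw [contraction, LinearMap.sum_apply]
  refine Eq.trans (Finset.sum_congr rfl fun i _ => ?_) h1
  simp only [Module.End.mul_apply]
  rw [lmap_pow_incl, DirectSum.lmap_lof, lmap_pow_incl]

theorem commute_lmap (p : ℕ) {f g : ∀ m, Module.End k (C.X (stretch p m))}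
    (hc : ∀ m, Commute (f m) (g m)) :
    Commute (DirectSum.lmap f : Module.End k (C.Stretched p)) (DirectSum.lmap g) := by
  refine C.incl_ext fun m x => ?_
  rw [Module.End.mul_apply, Module.End.mul_apply, DirectSum.lmap_lof, DirectSum.lmap_lof,
    DirectSum.lmap_lof, DirectSum.lmap_lof]
  exact congrArg _ (LinearMap.congr_fun (hc m) x)

end

variable {p n : ℕ} [hp : Fact p.Prime] {k : Type u} [Field k] [CharP k p]
  (C : ModuleComplex k (ElemAbGroupRing p n k))

/-- The `p`-complex obtained by repeating the modules of odd degree `p - 1` times, with the action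
of the elements `gᵢ - 1` of the group ring. -/
def stretched : NilpotentActionComplex p n k where
  carrier := C.Stretched p
  grading m := LinearMap.range (C.incl p m)
  isInternal := C.range_incl_isInternal p
  d := C.stretchD p
  d_mem := by
    rintro m _ ⟨x, rfl⟩
    exact ⟨_, (C.stretchD_incl p m x).symm⟩
  d_pow := by
    refine C.incl_ext fun m x => ?_
    -- Going down `p` places lowers the degree in `C` by two, where `trans` vanishes.
    have := stretch_add_self hp.1.pos (m - p)
    rw [sub_add_cancel] at this
    rw [C.stretchD_pow_incl p p rfl, C.trans_eq_zero (by omega), LinearMap.zero_apply,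
      LinearMap.zero_apply, map_zero]
  y i := DirectSum.lmap fun m => nilAct p k (C.X (stretch p m)) i
  y_mem := by
    rintro i m _ ⟨x, rfl⟩
    exact ⟨_, (DirectSum.lmap_lof (fun m => nilAct p k (C.X (stretch p m)) i) m x).symm⟩
  y_comm i j := C.commute_lmap p fun m => nilAct_commute p k _ i j
  d_comm i := by
    refine C.incl_ext fun m x => ?_
    rw [Module.End.mul_apply, Module.End.mul_apply, DirectSum.lmap_lof, stretchD_incl,
      stretchD_incl, DirectSum.lmap_lof, nilAct_apply, nilAct_apply, map_smul]
  y_pow i := by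
    refine C.incl_ext fun m x => ?_
    rw [lmap_pow_incl, nilAct_pow, LinearMap.zero_apply, LinearMap.zero_apply, map_zero]

theorem exists_homotopy_stretched
    (hproj : ∀ i, Module.Projective (ElemAbGroupRing p n k) (C.X i)) (i : Fin n) :
    ∃ h : Module.End k C.stretched.carrier,
      (∀ j, ∀ v ∈ C.stretched.grading j, h v ∈ C.stretched.grading j) ∧
      contraction p (C.stretched.y i) h = 1 ∧ ∀ j, j ≠ i → Commute (C.stretched.y j) h := by
  have := fun m => exists_homotopy_nilAct p k (C.X (stretch p m)) i
  choose h hc hcomm using this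
  refine ⟨DirectSum.lmap h, ?_, C.contraction_lmap p hc, fun j hj =>
    C.commute_lmap p fun m => hcomm m j hj⟩
  rintro m _ ⟨x, rfl⟩
  exact ⟨_, (DirectSum.lmap_lof h m x).symm⟩

theorem stretched_grading_eq_bot {a b : ℤ}
    (hab : ∀ i, i < a ∨ b < i → Subsingleton (C.X i)) (m : ℤ)
    (hm : m < p * (min a 0 - 1) ∨ p * (max b 0 + 1) < m) : C.stretched.grading m = ⊥ := by
  have : Subsingleton (C.X (stretch p m)) := by
    refine hab _ ?_
    -- Comparing the bounds with `0` ensures `2 (min a 0 - 1) < a` and `b < 2 (max b 0 + 1)`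
    -- whatever the signs.
    rcases hm with hm | hm
    · have := stretch_mono p hm.le
      rw [stretch_mul hp.1.pos] at this
      omega
    · have := stretch_mono p hm.le
      rw [stretch_mul hp.1.pos] at this
      omega
  rw [eq_bot_iff]
  rintro _ ⟨x, rfl⟩
  rw [Subsingleton.elim x 0, map_zero]
  exact zero_mem _

theorem stretched_finite {a b : ℤ} (hab : ∀ i, i < a ∨ b < i → Subsingleton (C.X i))
    (hfin : ∀ i, Module.Finite k (C.X i)) : Module.Finite k C.stretched.carrier := by
  rw [Module.finite_def, ← C.stretched.isInternal.submodule_iSup_eq_top]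
  have : ⨆ m, C.stretched.grading m =
      ⨆ m ∈ Finset.Icc (p * (min a 0 - 1)) (p * (max b 0 + 1)), C.stretched.grading m := by
    refine le_antisymm (iSup_le fun m => ?_) (iSup₂_le fun m _ => le_iSup _ m)
    by_cases hm : m ∈ Finset.Icc (p * (min a 0 - 1)) (p * (max b 0 + 1))
    · exact le_iSup₂_of_le m hm le_rfl
    · rw [C.stretched_grading_eq_bot hab m]
      · exact bot_le
      · rw [Finset.mem_Icc] at hm; omega
  rw [this]
  refine Submodule.fg_biSup _ _ fun m _ => ?_
  have := hfin (stretch p m)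
  have h : (LinearMap.range (C.incl p m)).FG := by
    rw [LinearMap.range_eq_map]
    exact Module.Finite.fg_top.map _
  exact h

theorem mem_cycles_stretched {s : ℕ} {m : ℤ} (x : C.X (stretch p m)) :
    C.incl p m x ∈ C.stretched.cycles s m ↔ C.trans (stretch p m) (stretch p (m - s)) x = 0 := by
  have h : (C.stretchD p ^ s) (C.incl p m x) = 0 ↔
      C.trans (stretch p m) (stretch p (m - s)) x = 0 := by
    rw [C.stretchD_pow_incl p s rfl, (C.incl_injective p _).eq_iff' (map_zero _)]
  exact ⟨fun hx => h.1 hx.2, fun hx => ⟨⟨x, rfl⟩, h.2 hx⟩⟩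

theorem mem_boundaries_stretched {s : ℕ} (hs : s ≤ p) {m : ℤ} (x : C.X (stretch p m)) :
    C.incl p m x ∈ C.stretched.boundaries s m ↔
      ∃ y, C.trans (stretch p (m + p - s)) (stretch p m) y = x := by
  have h : ∀ y, (C.stretchD p ^ (p - s)) (C.incl p (m + p - s) y) =
      C.incl p m (C.trans (stretch p (m + p - s)) (stretch p m) y) := fun y =>
    C.stretchD_pow_incl p _ (by rw [Nat.cast_sub hs]; ring) y
  constructor
  · rintro ⟨_, ⟨y, rfl⟩, hy⟩
    exact ⟨y, C.incl_injective p m ((h y).symm.trans hy)⟩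
  · rintro ⟨y, rfl⟩
    exact ⟨_, ⟨y, rfl⟩, h y⟩

/-- There is a place `m` of degree `i` in `C` such that `m - s` has degree `i - 1`; then `m + p - s`
has degree `i + 1`, and the `s`-cycles and `s`-boundaries at `m` are those of `C` in degree `i`. -/
theorem exists_not_cycles_stretched_le {i : ℤ} (h : ¬ C.cycles i ≤ C.boundaries i) {s : ℕ}
    (hs : 1 ≤ s) (hsp : s ≤ p - 1) :
    ∃ m, ¬ C.stretched.cycles s m ≤ C.stretched.boundaries s m := by
  have hpos := hp.1.pos
  obtain ⟨m, rfl, hm⟩ := exists_stretch_eq (p := p) (s := s) (by omega) (by omega) i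
  refine ⟨m, fun hle => h fun z hz => ?_⟩
  have hb := hle ((C.mem_cycles_stretched z).2 ((C.trans_eq_d rfl hm z).2 hz))
  refine (C.exists_trans_eq ?_ z).1 ((C.mem_boundaries_stretched (by omega) z).1 hb)
  rw [show m + (p : ℤ) - s = (m - s) + p by ring, stretch_add_self hpos, hm]; ring

theorem eDim_homology_stretched_le (m : ℤ) (hm : stretch p (m - 1) = stretch p m - 1) :
    eDim k (C.stretched.homology 1 m) ≤ eDim k (C.homology (stretch p m)) := by
  have hpos := hp.1.pos
  let f : C.cycles (stretch p m) →ₗ[k] C.stretched.cycles 1 m :=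
    (C.incl p m).restrict fun x hx =>
      (C.mem_cycles_stretched x).2 ((C.trans_eq_d rfl (by exact_mod_cast hm) x).2 hx)
  have hf : (C.boundaries (stretch p m)).submoduleOf (C.cycles (stretch p m)) ≤
      ((C.stretched.boundaries 1 m).submoduleOf (C.stretched.cycles 1 m)).comap f := by
    intro x hx
    refine (C.mem_boundaries_stretched hp.1.one_le _).2 ((C.exists_trans_eq ?_ _).2 hx)
    rw [Nat.cast_one, show m + (p : ℤ) - 1 = (m - 1) + p by ring, stretch_add_self hpos, hm]; ring
  refine Cardinal.toENat.monotone' (LinearMap.rank_le_of_surjective (Submodule.mapQ _ _ f hf) ?_)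
  intro q
  obtain ⟨⟨z, hz⟩, rfl⟩ := Submodule.mkQ_surjective _ q
  obtain ⟨x, rfl⟩ := hz.1
  exact ⟨Submodule.mkQ _ ⟨x, (C.trans_eq_d rfl (by exact_mod_cast hm) x).1
    ((C.mem_cycles_stretched x).1 hz)⟩, rfl⟩

/-- The differential leaving place `m` is an identity map here, so there are no nonzero cycles. -/
theorem eDim_homology_stretched_eq_zero (m : ℤ) (hm : stretch p (m - 1) = stretch p m) :
    eDim k (C.stretched.homology 1 m) = 0 := by
  have : Subsingleton (C.stretched.cycles 1 m) := by
    refine subsingleton_of_forall_eq 0 ?_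
    rintro ⟨z, hz⟩
    obtain ⟨x, rfl⟩ := hz.1
    have h1 := (C.mem_cycles_stretched x).1 hz
    have h2 := C.trans_trans (stretch_mono p (show m - (1 : ℕ) ≤ m by omega))
      (show stretch p m ≤ stretch p (m - (1 : ℕ)) by rw [Nat.cast_one, hm]) x
    rw [h1, map_zero, trans_self] at h2
    exact Subtype.ext ((congrArg (C.incl p m) h2.symm).trans (map_zero _))
  have : Subsingleton (C.stretched.homology 1 m) := Submodule.mkQ_surjective _ |>.subsingleton
  rw [eDim, rank_subsingleton']
  simp

/-- Only places where the degree drops contribute, and there is exactly one of them, `ψ i`, for each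
degree `i` of `C`. -/
theorem homologyDim_stretched_le :
    C.stretched.homologyDim 1 ≤ ∑' i, eDim k (C.homology i) := by
  have hp2 := hp.1.two_le
  have := exists_stretch_eq (p := p) one_pos (by omega)
  choose ψ h1 h2 using this
  have hψ : Function.Injective ψ := Function.LeftInverse.injective h1
  have hsupp : Function.support (fun m => eDim k (C.stretched.homology 1 m)) ⊆ Set.range ψ := by
    intro m hm
    have h3 := (stretch_sub_one hp2 m).resolve_left fun h =>
      hm (C.eDim_homology_stretched_eq_zero m h)
    exact ⟨stretch p m, eq_of_stretch_eq ((h2 _).trans (by rw [h1])) h3 (h1 _)⟩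
  rw [NComplex.homologyDim, ← hψ.tsum_eq hsupp]
  have hle : ∀ i, eDim k (C.stretched.homology 1 (ψ i)) ≤ eDim k (C.homology i) := by
    intro i
    have := C.eDim_homology_stretched_le (ψ i) ((h2 i).trans (by rw [h1]))
    rwa [h1] at this
  exact ENat.summable.tsum_le_tsum hle ENat.summable

/-- A bounded complex of finite-dimensional projective modules over the group ring with nonzero
homology gives rise to a `p`-DG module whose fiber homology is at most as large. -/
theorem exists_mem_fiberHomologyDims_le {a b : ℤ}
    (hab : ∀ i, i < a ∨ b < i → Subsingleton (C.X i)) (hfin : ∀ i, Module.Finite k (C.X i))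
    (hproj : ∀ i, Module.Projective (ElemAbGroupRing p n k) (C.X i))
    (hne : ∃ i, ¬ C.cycles i ≤ C.boundaries i) :
    ∃ D ∈ fiberHomologyDims p n k, D ≤ ∑' i, eDim k (C.homology i) := by
  obtain ⟨i, hi⟩ := hne
  have := C.stretched_finite hab hfin
  have hpos := hp.1.pos
  let V := C.stretched
  have hdim : ∀ s, V.homologyDim s = V.toPDGModule.fiber.homologyDim s :=
    NComplex.homologyDim_eq V.fiberEquiv V.fiberEquiv_d V.map_fiberEquiv_grading
  refine ⟨_, ⟨V.toPDGModule, V.toPDGModule_isFree, V.toPDGModule_isFG, fun s hs hsp => ?_,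
    fun s hs hsp => V.totalHomology_toPDGModule_finite (C.stretched_grading_eq_bot hab)
      (C.exists_homotopy_stretched hproj) s (by omega), rfl⟩,
    (hdim 1).symm.le.trans C.homologyDim_stretched_le⟩
  obtain ⟨m, hm⟩ := C.exists_not_cycles_stretched_le hi hs hsp
  refine V.toPDGModule.fiber.totalHomology_nontrivial (i := m) ?_
  rw [← NComplex.map_cycles V.fiberEquiv V.fiberEquiv_d V.map_fiberEquiv_grading,
    ← NComplex.map_boundaries V.fiberEquiv V.fiberEquiv_d V.map_fiberEquiv_grading]
  rwa [Submodule.map_le_map_iff_of_injective V.fiberEquiv.injective]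

end ModuleComplex

/-! ### Categorical chain complexes and the regular module -/

open CategoryTheory

namespace ModuleComplex

section

variable {k R : Type u} [Field k] [Ring R] [Algebra k R] (C : ChainComplex (ModuleCat.{u} R) ℤ)

/-- The explicit form of a chain complex in the category of modules. -/
def ofChainComplex : ModuleComplex k R where
  X i := C.X i
  moduleBase i := Module.compHom (C.X i) (algebraMap k R)
  isScalarTower i :=
    letI : Module k (C.X i) := Module.compHom (C.X i) (algebraMap k R)
    ⟨fun a r x => by
      rw [Algebra.smul_def, mul_smul]
      rfl⟩
  d i j := (C.d i j).hom
  shape i j h := by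
    rw [C.shape i j h]
    rfl
  d_comp i j l x := by
    have := C.d_comp_d i j l
    exact LinearMap.congr_fun (congrArg ModuleCat.Hom.hom this) x

theorem exists_not_cycles_le_of_not_acyclic (h : ¬ C.Acyclic) :
    ∃ i, ¬ (ofChainComplex (k := k) C).cycles i ≤ (ofChainComplex (k := k) C).boundaries i := by
  by_contra! H
  refine h fun i => ?_
  rw [C.exactAt_iff' (i + 1) i (i - 1) (by simp) (by simp), ShortComplex.moduleCat_exact_iff]
  exact fun x hx => H i hx

theorem eDim_homology_ofChainComplex_le (i : ℤ) :
    eDim k ((ofChainComplex (k := k) C).homology i) ≤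
      eDim k ((ModuleCat.restrictScalars (algebraMap k R)).obj (C.homology i)) := by
  let S := C.sc' (i + 1) i (i - 1)
  let e : C.homology i ≅ S.moduleCatLeftHomologyData.H :=
    ShortComplex.homologyMapIso (C.isoSc' (i + 1) i (i - 1) (by simp) (by simp)) ≪≫
      S.moduleCatHomologyIso
  -- The projection from cycles to the categorical homology, with kernel the boundaries; restricted
  -- to scalars in `k`, it induces an injection of the explicit homology, which is all the
  -- inequality needs.
  let q : LinearMap.ker S.g.hom →ₗ[R] C.homology i :=
    e.inv.hom ∘ₗ (LinearMap.range S.moduleCatToCycles).mkQ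
  have hq : ∀ z, q z = 0 ↔ ∃ x, S.f x = z := by
    intro z
    have h1 : q z = 0 ↔ (LinearMap.range S.moduleCatToCycles).mkQ z = 0 :=
      e.toLinearEquiv.symm.map_eq_zero_iff
    rw [h1, Submodule.mkQ_apply, Submodule.Quotient.mk_eq_zero]
    exact ⟨fun ⟨x, hx⟩ => ⟨x, congrArg Subtype.val hx⟩, fun ⟨x, hx⟩ => ⟨x, Subtype.ext hx⟩⟩
  let D := ofChainComplex (k := k) C
  let f : D.cycles i →ₗ[k] (ModuleCat.restrictScalars (algebraMap k R)).obj (C.homology i) :=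
    { toFun := fun z => q ⟨z.1, z.2⟩
      map_add' := fun x y => q.map_add ⟨x.1, x.2⟩ ⟨y.1, y.2⟩
      map_smul' := fun c x => q.map_smul (algebraMap k R c) ⟨x.1, x.2⟩ }
  have hf : ∀ z, f z = 0 ↔ z ∈ (D.boundaries i).submoduleOf (D.cycles i) := fun z =>
    hq ⟨z.1, z.2⟩
  let g : D.homology i →ₗ[k]
      (ModuleCat.restrictScalars (algebraMap k R)).obj (C.homology i) :=
    Submodule.liftQ ((D.boundaries i).submoduleOf (D.cycles i)) f fun z hz =>
      LinearMap.mem_ker.2 ((hf z).2 hz)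
  refine Cardinal.toENat.monotone' (LinearMap.rank_le_of_injective g ?_)
  rw [injective_iff_map_eq_zero]
  intro z hz
  obtain ⟨z, rfl⟩ := Submodule.mkQ_surjective _ z
  rw [Submodule.mkQ_apply, Submodule.Quotient.mk_eq_zero]
  exact (hf z).1 hz

end

section

variable (k R : Type u) [Field k] [Ring R] [Algebra k R]

/-- The regular module, as a complex concentrated in degree `0`. -/
def regular : ModuleComplex k R where
  X i := ↥(if i = 0 then ⊤ else ⊥ : Submodule R R)
  d _ _ := 0
  shape _ _ _ := rfl
  d_comp _ _ _ _ := rfl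

theorem regular_subsingleton {i : ℤ} (hi : i ≠ 0) : Subsingleton ((regular k R).X i) := by
  change Subsingleton ↥(if i = 0 then ⊤ else ⊥ : Submodule R R)
  rw [if_neg hi]
  infer_instance

theorem regular_finite [Module.Finite k R] (i : ℤ) : Module.Finite k ((regular k R).X i) := by
  change Module.Finite k ↥(if i = 0 then ⊤ else ⊥ : Submodule R R)
  exact Module.Finite.of_injective
    ((if i = 0 then ⊤ else ⊥ : Submodule R R).subtype.restrictScalars k) Subtype.val_injective

theorem regular_projective (i : ℤ) : Module.Projective R ((regular k R).X i) := by
  change Module.Projective R ↥(if i = 0 then ⊤ else ⊥ : Submodule R R)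
  by_cases hi : i = 0
  · rw [if_pos hi]
    exact Module.Projective.of_equiv Submodule.topEquiv.symm
  · rw [if_neg hi]
    infer_instance

theorem regular_not_exact [Nontrivial R] :
    ¬ (regular k R).cycles 0 ≤ (regular k R).boundaries 0 := by
  intro h
  have h1 : (1 : R) ∈ (if (0 : ℤ) = 0 then ⊤ else ⊥ : Submodule R R) := by
    rw [if_pos rfl]; trivial
  obtain ⟨x, hx⟩ := h (show (⟨1, h1⟩ : (regular k R).X 0) ∈ (regular k R).cycles 0 from rfl)
  have h2 : (0 : R) = 1 := congrArg Subtype.val hx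
  exact zero_ne_one h2

theorem tsum_eDim_homology_regular_lt_top [Module.Finite k R] :
    ∑' i, eDim k ((regular k R).homology i) < ⊤ := by
  rw [tsum_eq_single 0]
  · have := regular_finite k R 0
    rw [eDim, ← Module.finrank_eq_rank, Cardinal.toENat_nat]
    exact ENat.natCast_lt_top _
  · intro i hi
    have := regular_subsingleton k R hi
    have : Subsingleton ((regular k R).homology i) := Submodule.mkQ_surjective _ |>.subsingleton
    rw [eDim, rank_subsingleton']
    simp

end

end ModuleComplex

end

theorem theorem4p7 (p : ℕ) [Fact p.Prime] (n : ℕ) (k : Type u) [Field k] [CharP k p] :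
    ∃ b : ℕ, IsLeast (fiberHomologyDims p n k) (b : ℕ∞) ∧
      ∀ C : ChainComplex (ModuleCat.{u} (ElemAbGroupRing p n k)) ℤ,
        IsPerfectComplex C → ¬ C.Acyclic → (b : ℕ∞) ≤ chainHomologyDim k C := by
  have hfinR : Module.Finite k (ElemAbGroupRing p n k) :=
    Module.Finite.of_basis (MonoidAlgebra.basis _ k)
  obtain ⟨D₀, hD₀, hle⟩ := (ModuleComplex.regular k (ElemAbGroupRing p n k))
    |>.exists_mem_fiberHomologyDims_le (a := 0) (b := 0)
    (fun i hi => ModuleComplex.regular_subsingleton k _ (by omega))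
    (ModuleComplex.regular_finite k _) (ModuleComplex.regular_projective k _)
    ⟨0, ModuleComplex.regular_not_exact k _⟩
  -- The regular module in degree `0` supplies a member of the set with finite value.
  have hfin : sInf (fiberHomologyDims p n k) ≠ ⊤ :=
    ((sInf_le hD₀).trans_lt (hle.trans_lt
      (ModuleComplex.tsum_eDim_homology_regular_lt_top k _))).ne
  refine ⟨(sInf (fiberHomologyDims p n k)).toNat, ?_, ?_⟩
  · rw [ENat.natCast_toNat hfin]
    exact ⟨csInf_mem ⟨D₀, hD₀⟩, fun _ h => sInf_le h⟩
  · rw [ENat.natCast_toNat hfin]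
    rintro C ⟨⟨a, b, hab⟩, hC⟩ hne
    obtain ⟨D, hD, hDle⟩ := (ModuleComplex.ofChainComplex (k := k) C)
      |>.exists_mem_fiberHomologyDims_le (a := a) (b := b)
      (fun i hi => ModuleCat.subsingleton_of_isZero (hab i hi))
      (fun i => by
        have : Module.Finite (ElemAbGroupRing p n k)
          ((ModuleComplex.ofChainComplex (k := k) C).X i) := (hC i).1
        exact Module.Finite.trans (ElemAbGroupRing p n k) _)
      (fun i => (hC i).2) (ModuleComplex.exists_not_cycles_le_of_not_acyclic C hne)
    refine (sInf_le hD).trans (hDle.trans ?_)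
    exact ENat.summable.tsum_le_tsum
      (ModuleComplex.eDim_homology_ofChainComplex_le C) ENat.summable
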